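/- Let $G$ be a (finite-dimensional, real, smooth) Lie group with Lie algebra $\mathfrak g=T_eG$ and identity $e$. Let $T^*G$ carry its canonical symplectic form $\omega=-\mathbf d\theta$, where $\theta_\alpha(v)=\langle\alpha,T\pi\cdot v\rangle$ and $\pi:T^*G\to G$ is the projection, and let $\omega_B$ be the corresponding two-form on $G\times\mathfrak g^*$ obtained through the left trivialization $T^*G\to G\times\mathfrak g^*$, $\alpha_g\mapsto(g,T_e^*L_g\cdot\alpha_g)$ (body coordinates). It is nondegenerate. For a smooth function $f$ on $G\times\mathfrak g^*$ the Hamiltonian vector field $X_f$ is defined by $\omega_B(X_f,\cdot)=\mathbf df$. Let $h\in C^\infty(G\times\mathfrak g^*)$ be such that $X_h$ has an equilibrium at $(g,\mu)$, i.e. $X_h(g,\mu)=0$. Let $\varphi_g:G\times\mathfrak g^*\to G\times\mathfrak g^*$ be the cotangent lift of the left translation by $g$ on $G$, expressed in body coordinates, and let $h^g:=h\circ\varphi_g$. Then: (i) $\varphi_g(e,\mu)=(g,\mu)$, and $X_{h^g}$ has an equilibrium at $(e,\mu)$. (ii) Let $\Phi_g:=T_{(e,\mu)}\varphi_g:T_{(e,\mu)}(G\times\mathfrak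 g^*)\simeq\mathfrak g\times\mathfrak g^*\to T_{(g,\mu)}(G\times\mathfrak g^*)$, and let $Q(v)=\tfrac12\mathbf d^2h(g,\mu)(v,v)$ and $Q^g(v)=\tfrac12\mathbf d^2h^g(e,\mu)(v,v)$ be the quadratic forms of the second derivatives at these critical points. Let $X_Q$ and $X_{Q^g}$ be the Hamiltonian vector fields of $Q$ and $Q^g$ on the symplectic vector spaces $T_{(g,\mu)}(G\times\mathfrak g^*)$ and $T_{(e,\mu)}(G\times\mathfrak g^*)$ with the constant forms $\omega_B(g,\mu)$ and $\omega_B(e,\mu)$. Then $$Q^g=Q\circ\Phi_g ,$$ $X_Q$ and $X_{Q^g}$ are linear maps, and $$\Phi_g\circ X_{Q^g}=X_Q\circ\Phi_g .$$ Moreover $X_Q$ and $X_{Q^g}$ are the linearizations of $X_h$ at $(g,\mu)$ and of $X_{h^g}$ at $(e,\mu)$, where the linearization of a vector field $X$ at an equilibrium $m_0$ is $v\mapsto\frac{d}{d\lambda}\big|_{\lambda=0}T_{m_0}F_\lambda\cdot v$, with $F_\lambda$ the (local) flow of $X$. (iii) Let ${\rm Hess}$ be the linear map from $\mathfrak g\times\mathfrak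 g^*$ to its dual $(\mathfrak g\times\mathfrak g^*)^*\simeq\mathfrak g^*\times\mathfrak g$ defined by $\langle{\rm Hess}(\xi,\tau),(\eta,\rho)\rangle=\mathbf d^2h^g(e,\mu)((\xi,\tau),(\eta,\rho))$, and write ${\rm Hess}(\xi,\tau)=(\pi_{\mathfrak g}{\rm Hess}(\xi,\tau),\pi_{\mathfrak g^*}{\rm Hess}(\xi,\tau))\in\mathfrak g^*\times\mathfrak g$, so that $\pi_{\mathfrak g}{\rm Hess}(\xi,\tau)$ pairs with $\eta\in\mathfrak g$ and $\pi_{\mathfrak g^*}{\rm Hess}(\xi,\tau)$ with $\rho\in\mathfrak g^*$. Then for all $(\xi,\tau)\in\mathfrak g\times\mathfrak g^*$ $$X_{Q^g}(\xi,\tau)=\bigl(\pi_{\mathfrak g^*}{\rm Hess}(\xi,\tau),\;-\pi_{\mathfrak g}{\rm Hess}(\xi,\tau)+{\rm ad}^*_{\pi_{\mathfrak g^*}{\rm Hess}(\xi,\tau)}\mu\bigr),$$ where $\langle{\rm ad}^*_\xi\mu,\eta\rangle=\langle\mu,[\xi,\eta]\rangle$. -/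

import Mathlib

open scoped Manifold ContDiff Topology

noncomputable section

section Manifolds

variable {E : Type*} [NormedAddCommGroup E] [NormedSpace ℝ E]
  {H : Type*} [TopologicalSpace H] (I : ModelWithCorners ℝ E H)
  {M : Type*} [TopologicalSpace M] [ChartedSpace H M]

/-- The exterior derivative of a differential `n`-form on a manifold without boundary. At the point
`m` it is computed in the preferred chart at `m`: read the form in the chart, differentiate it on
the model space, and pull the result back to the tangent space at `m`. -/
def mextDeriv {n : ℕ} (η : ∀ x : M, TangentSpace I x [⋀^Fin n]→L[ℝ] ℝ) (m : M) :
    TangentSpace I m [⋀^Fin (n + 1)]→L[ℝ] ℝ :=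
  (extDeriv
    (fun y : E =>
      ((η ((extChartAt I m).symm y)).compContinuousLinearMap
        (mfderiv 𝓘(ℝ, E) I (extChartAt I m).symm y) : E [⋀^Fin n]→L[ℝ] ℝ))
    (extChartAt I m m)).compContinuousLinearMap
      (mfderiv I 𝓘(ℝ, E) (extChartAt I m) m : TangentSpace I m →L[ℝ] E)

/-- The second derivative `d²f(m)(v, w)` of a function on a manifold without boundary, read in the
preferred chart at `m` (whose differential identifies the tangent space at `m` with the model
space). It is used only at critical points of `f`, where it does not depend on the chart. -/
def hessianAt (f : M → ℝ) (m : M) (v w : E) : ℝ :=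
  fderiv ℝ (fderiv ℝ (f ∘ (extChartAt I m).symm)) (extChartAt I m m) v w

/-- The quadratic form `Q(v) = ½ d²f(m)(v, v)`, so that `dQ(v) · w = d²f(m)(v, w)`. -/
def hessianQuadraticForm (f : M → ℝ) (m : M) (v : E) : ℝ :=
  (1 / 2 : ℝ) * hessianAt I f m v v

open Classical in
/-- The vector `v` determined by `Ω(v, ·) = α`, for a two-form `Ω` and a covector `α` on a vector
space. (The value is `0` if there is no such vector or more than one.) -/
def hamiltonianVector {V : Type*} [AddCommGroup V] [Module ℝ V] [TopologicalSpace V]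
    (Ω : V [⋀^Fin 2]→L[ℝ] ℝ) (α : V →L[ℝ] ℝ) : V :=
  if hα : ∃! v : V, ∀ w : V, Ω ![v, w] = α w then hα.choose else 0

/-- The Hamiltonian vector field `X_f` of a function `f` on a manifold with a two-form `Ω`:
`Ω(X_f, ·) = df`. -/
def hamiltonianVectorField (Ω : ∀ x : M, TangentSpace I x [⋀^Fin 2]→L[ℝ] ℝ) (f : M → ℝ) (m : M) :
    TangentSpace I m :=
  hamiltonianVector (Ω m) (mfderiv I 𝓘(ℝ, ℝ) f m : TangentSpace I m →L[ℝ] ℝ)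

/-- The Hamiltonian vector field `X_Q` of a function `Q` on a vector space with a constant
two-form `Ω`: `Ω(X_Q(v), w) = dQ(v) · w`. -/
def linearHamiltonianVectorField (Ω : E [⋀^Fin 2]→L[ℝ] ℝ) (Q : E → ℝ) (v : E) : E :=
  hamiltonianVector Ω (fderiv ℝ Q v)

/-- `F` is a smooth local flow of the vector field `X` near the point `m` and near time `0`. -/
structure IsLocalFlowAt (X : ∀ x : M, TangentSpace I x) (m : M) (F : ℝ → M → M) : Prop where
  contMDiffAt : ContMDiffAt (𝓘(ℝ, ℝ).prod I) I ∞ (fun p : ℝ × M => F p.1 p.2) (0, m)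
  initial : ∀ᶠ x in 𝓝 m, F 0 x = x
  integralCurve : ∀ᶠ p : ℝ × M in 𝓝 (0, m),
    HasMFDerivAt 𝓘(ℝ, ℝ) I (fun t : ℝ => F t p.2) p.1
      ((1 : ℝ →L[ℝ] ℝ).smulRight (X (F p.1 p.2)))

/-- `L` is the linearization of the vector field `X` at its equilibrium `m`: for the flow `F` of
`X`, `L v = d/dt|₀ (T_m F_t · v)`. (A smooth vector field on a manifold without boundary has
a smooth local flow near `m`, and any two agree near `(0, m)`. As `F_t(m) = m` for
small `t`, the curve `t ↦ T_m F_t · v` lies in the fixed vector space `T_m M`.) -/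
def IsLinearizationAt (X : ∀ x : M, TangentSpace I x) (m : M) (L : E → E) : Prop :=
  X m = 0 ∧ ∀ F : ℝ → M → M, IsLocalFlowAt I X m F →
    ∀ v : E, HasDerivAt (fun t : ℝ => (mfderiv I I (F t) m v : E)) (L v) 0

end Manifolds

section CotangentBundle

variable {E : Type*} [NormedAddCommGroup E] [NormedSpace ℝ E]
  {H : Type*} [TopologicalSpace H] (I : ModelWithCorners ℝ E H)
  (M : Type*) [TopologicalSpace M] [ChartedSpace H M]

/-- The cotangent bundle `T*M`, as the bundle of continuous linear maps from the tangent bundle to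
the trivial line bundle. -/
abbrev CotangentBundle : Type _ :=
  Bundle.TotalSpace (E →L[ℝ] ℝ) (fun x : M => TangentSpace I x →L[ℝ] Bundle.Trivial M ℝ x)

variable [IsManifold I 1 M]

/-- The canonical (Liouville) one-form `θ` on `T*M`: `θ_α(v) = α(Tπ · v)`. -/
def canonicalOneForm (α : CotangentBundle I M) :
    TangentSpace (I.prod 𝓘(ℝ, E →L[ℝ] ℝ)) α [⋀^Fin 1]→L[ℝ] ℝ :=
  ContinuousAlternatingMap.ofSubsingleton ℝ _ ℝ (0 : Fin 1)
    ((α.2 : E →L[ℝ] ℝ) ∘L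
      (mfderiv (I.prod 𝓘(ℝ, E →L[ℝ] ℝ)) I
        (fun β : CotangentBundle I M => β.proj) α :
          TangentSpace (I.prod 𝓘(ℝ, E →L[ℝ] ℝ)) α →L[ℝ] E))

/-- The canonical symplectic form `Ω = -dθ` on `T*M`. -/
def canonicalSymplecticForm (α : CotangentBundle I M) :
    TangentSpace (I.prod 𝓘(ℝ, E →L[ℝ] ℝ)) α [⋀^Fin 2]→L[ℝ] ℝ :=
  -mextDeriv (I.prod 𝓘(ℝ, E →L[ℝ] ℝ)) (canonicalOneForm I M) α

end CotangentBundle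

section LieGroups

variable {E : Type*} [NormedAddCommGroup E] [NormedSpace ℝ E]
  {H : Type*} [TopologicalSpace H] (I : ModelWithCorners ℝ E H)
  {G : Type*} [TopologicalSpace G] [ChartedSpace H G] [Group G]

/-- The dual `𝔤*` of the Lie algebra `𝔤 = T_e G`. Mathlib's tangent spaces are copies of the model
space `E`, whose norm makes `𝔤*` a normed space. -/
abbrev LieAlgebraDual (_I : ModelWithCorners ℝ E H) (G : Type*) [TopologicalSpace G]
    [ChartedSpace H G] [Group G] : Type _ :=
  E →L[ℝ] ℝ

/-- The tangent map `T_x L_g : T_x G → T_{gx} G` of the left translation by `g`. -/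
def tangentLeftMul (g x : G) : E →L[ℝ] E :=
  mfderiv I I (fun y : G => g * y) x

/-- The left trivialization (body coordinates) `λ : T*G → G × 𝔤*`, `α_g ↦ (g, T_e* L_g · α_g)`. -/
def bodyCoordinates (α : CotangentBundle I G) : G × LieAlgebraDual I G :=
  (α.proj, (α.2 : E →L[ℝ] ℝ) ∘L tangentLeftMul I α.proj 1)

/-- The inverse of the left trivialization, `(g, μ) ↦ T_g* L_{g⁻¹} · μ`. -/
def bodyCoordinatesInv (z : G × LieAlgebraDual I G) : CotangentBundle I G :=
  ⟨z.1, (z.2 ∘L tangentLeftMul I z.1⁻¹ z.1 : E →L[ℝ] ℝ)⟩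

/-- The canonical symplectic form of `T*G` in body coordinates, a two-form on `G × 𝔤*`. -/
def bodySymplecticForm [IsManifold I 1 G] (z : G × LieAlgebraDual I G) :
    TangentSpace (I.prod 𝓘(ℝ, LieAlgebraDual I G)) z [⋀^Fin 2]→L[ℝ] ℝ :=
  (canonicalSymplecticForm I G (bodyCoordinatesInv I z)).compContinuousLinearMap
    (mfderiv (I.prod 𝓘(ℝ, LieAlgebraDual I G)) (I.prod 𝓘(ℝ, E →L[ℝ] ℝ))
      (bodyCoordinatesInv I) z)

/-- The cotangent lift to `T*G` of the left translation by `k`: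
`T_x* G ∋ α ↦ T_{kx}* L_{k⁻¹} · α ∈ T_{kx}* G`. -/
def cotangentLift (k : G) (α : CotangentBundle I G) : CotangentBundle I G :=
  ⟨k * α.proj, ((α.2 : E →L[ℝ] ℝ) ∘L tangentLeftMul I k⁻¹ (k * α.proj) : E →L[ℝ] ℝ)⟩

/-- The cotangent lift of the left translation by `k`, expressed in body coordinates. -/
def bodyAction (k : G) (z : G × LieAlgebraDual I G) : G × LieAlgebraDual I G :=
  bodyCoordinates I (cotangentLift I k (bodyCoordinatesInv I z))

/-- The coadjoint operator `ad*_ξ : 𝔤* → 𝔤*`, `⟨ad*_ξ μ, η⟩ = ⟨μ, [ξ, η]⟩`, on the dual of the Lie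
algebra of a finite-dimensional Lie group. -/
def coadjoint [FiniteDimensional ℝ E] [LieGroup I ∞ G] (ξ : GroupLieAlgebra I G)
    (μ : LieAlgebraDual I G) : LieAlgebraDual I G :=
  haveI : LieGroup I (minSmoothness ℝ 3) G :=
    LieGroup.of_le (n := ∞) (by
      rw [minSmoothness_of_isRCLikeNormedField]
      exact WithTop.coe_le_coe.2 (le_top : (3 : ℕ∞) ≤ ⊤))
  LinearMap.toContinuousLinearMap
    (((μ : E →L[ℝ] ℝ) : E →ₗ[ℝ] ℝ) ∘ₗ
      (show E →ₗ[ℝ] E from (LieAlgebra.ad ℝ (GroupLieAlgebra I G) ξ)))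

theorem coadjoint_apply [FiniteDimensional ℝ E] [LieGroup I ∞ G] (ξ η : GroupLieAlgebra I G)
    (μ : LieAlgebraDual I G) : coadjoint I ξ μ η = μ (⁅ξ, η⁆ : GroupLieAlgebra I G) :=
  rfl

/-- The manifold model of `G × 𝔤*`. -/
abbrev bodyModel (G : Type*) [TopologicalSpace G] [ChartedSpace H G] [Group G] :=
  I.prod 𝓘(ℝ, LieAlgebraDual I G)

/-- The Hamiltonian vector field `X_h` on `G × 𝔤*` of a function `h`. -/
def bodyHamiltonianVectorField [IsManifold I 1 G] (h : G × LieAlgebraDual I G → ℝ) :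
    ∀ z : G × LieAlgebraDual I G, TangentSpace (bodyModel I G) z :=
  hamiltonianVectorField (bodyModel I G) (bodySymplecticForm I) h

/-- The quadratic form `Q(v) = ½ d²h(z)(v, v)` on `T_z (G × 𝔤*)`. -/
def bodyQuadraticForm (h : G × LieAlgebraDual I G → ℝ) (z : G × LieAlgebraDual I G) :
    E × LieAlgebraDual I G → ℝ :=
  hessianQuadraticForm (bodyModel I G) h z

/-- The linear Hamiltonian vector field `X_Q` on the symplectic vector space `T_z (G × 𝔤*)` of the
quadratic form `Q(v) = ½ d²h(z)(v, v)`. -/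
def bodyLinearHamiltonianVectorField [IsManifold I 1 G] (h : G × LieAlgebraDual I G → ℝ)
    (z : G × LieAlgebraDual I G) : E × LieAlgebraDual I G → E × LieAlgebraDual I G :=
  linearHamiltonianVectorField (bodySymplecticForm I z) (bodyQuadraticForm I h z)

/-- The tangent map `Φ_g = T_{(e, μ)} φ_g` of the lifted left translation `φ_g`. -/
def bodyActionTangent (g : G) (μ : LieAlgebraDual I G) :
    E × LieAlgebraDual I G →L[ℝ] E × LieAlgebraDual I G :=
  mfderiv (bodyModel I G) (bodyModel I G) (bodyAction I g) ((1 : G), μ)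

end LieGroups

end

/-!
In a chart of `G` the left-invariant Maurer–Cartan form `T_k L_{k⁻¹} : T_k G → 𝔤` is a smooth family
`x ↦ A(x)` of invertible linear maps of the model space, and everything is read off from it.

The left trivialization turns the Liouville form of `T*G` into the one-form `ν ∘ A(x) ∘ dx` on
`G × 𝔤*` (`canonicalSymplecticForm_eq`, `bodySymplecticForm_eq`), so that
`ω_B = -d(ν ∘ A(x) ∘ dx)`, that is
`ω_B((a, α), (b, β)) = β(A a) - α(A b) - ν(dA(a) b - dA(b) a)` (`coframeTwoForm_apply`).
As `A(x)` is invertible this is nondegenerate (`existsUnique_coframeTwoForm`), and equilibria of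
`X_h` are critical points of `h`. In body coordinates the lifted left translation is
`(x, ν) ↦ (g x, ν)` (`bodyAction_apply`). It preserves `A`, hence its tangent map `Φ_g` is
symplectic (`maurerCartanInChart_comp_fderiv`, `coframeTwoForm_maurerCartan_pullback`,
`bodyChartForm_bodyActionTangent`).

Second derivatives at critical points are tensorial (`fderiv_fderiv_comp_of_critical`), which gives
`Q^g = Q ∘ Φ_g` (`hessianAt_comp_bodyAction`). A symplectic map that carries one quadratic form to
another conjugates their Hamiltonian vector fields, by nondegeneracy.

For the linearization, a vector field with a smooth flow `F` is `∂_t F` at `t = 0`, and symmetry of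
second derivatives identifies `d/dt|₀ T F_t` with the derivative of the field in a chart
(`hasDerivAt_fderiv_flow`, `isLinearizationAt_of_fderiv_chart`). Differentiating
`ω_B(X_h, ·) = dh` at a zero of `X_h`, where the derivative of `ω_B` does not contribute, gives
`ω_B(DX_h v, ·) = d²h(v, ·)`, the equation that defines `X_Q` (`apply_fderiv_of_hamiltonian`,
`isLinearizationAt_bodyHamiltonianVectorField`).

At the identity `A = id`, and the Maurer–Cartan equation `dA(a) b - dA(b) a = -[a, b]`
(`fderiv_maurerCartanInChart_sub`) shows that
`ω_B((a, α), (b, β)) = β(a) - α(b) + μ([a, b])` at `(e, μ)` (`bodyChartForm_one_apply`). Comparing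
the `𝔤` and `𝔤*` components of `ω_B(X_{Q^g}, ·) = d²h^g` yields the explicit formula
(`exists_hessian_components`).
-/

noncomputable section

/-! ### Two-forms of coframes on a vector space -/

/-- Over `ℝ`, smooth functions have symmetric second derivatives. -/
theorem minSmoothness_real_two_le : minSmoothness ℝ 2 ≤ (∞ : WithTop ℕ∞) := by
  rw [minSmoothness_of_isRCLikeNormedField]
  exact WithTop.coe_le_coe.2 (le_top : (2 : ℕ∞) ≤ ⊤)

theorem differentiableAt_extDeriv {W : Type*} [NormedAddCommGroup W] [NormedSpace ℝ W] {n : ℕ}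
    {η : W → W [⋀^Fin n]→L[ℝ] ℝ} {y : W} (h : ContDiffAt ℝ ∞ η y) :
    DifferentiableAt ℝ (extDeriv η) y := by
  have h' : ContDiffAt ℝ 1 (fderiv ℝ η) y := h.fderiv_right (by norm_cast)
  exact (ContinuousAlternatingMap.alternatizeUncurryFinCLM ℝ W ℝ).differentiableAt.comp y
    (h'.differentiableAt one_ne_zero)

section FrameForms

variable {E : Type*} [NormedAddCommGroup E] [NormedSpace ℝ E]

/-- The one-form `(x, ν) ↦ ν ∘ A(x) ∘ dx` on `E × E*` determined by an `E`-valued one-form `A` on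
`E`. For `A = id` it is the Liouville form of `T*E`; for `A` the Maurer–Cartan form of a Lie group
in a chart it is the Liouville form in body coordinates. -/
def coframeOneForm (A : E → E →L[ℝ] E) (y : E × (E →L[ℝ] ℝ)) :
    (E × (E →L[ℝ] ℝ)) [⋀^Fin 1]→L[ℝ] ℝ :=
  ContinuousAlternatingMap.ofSubsingleton ℝ _ ℝ (0 : Fin 1)
    ((y.2 ∘L A y.1) ∘L ContinuousLinearMap.fst ℝ E (E →L[ℝ] ℝ))

/-- The two-form `-d(ν ∘ A(x) ∘ dx)` on `E × E*`. -/
def coframeTwoForm (A : E → E →L[ℝ] E) (y : E × (E →L[ℝ] ℝ)) :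
    (E × (E →L[ℝ] ℝ)) [⋀^Fin 2]→L[ℝ] ℝ :=
  -extDeriv (coframeOneForm A) y

theorem coframeOneForm_apply (A : E → E →L[ℝ] E) (y : E × (E →L[ℝ] ℝ))
    (v : Fin 1 → E × (E →L[ℝ] ℝ)) : coframeOneForm A y v = y.2 (A y.1 (v 0).1) :=
  rfl

theorem contDiffAt_coframeOneForm {A : E → E →L[ℝ] E} {y : E × (E →L[ℝ] ℝ)} {n : WithTop ℕ∞}
    (hA : ContDiffAt ℝ n A y.1) : ContDiffAt ℝ n (coframeOneForm A) y := by
  have h₁ : ContDiffAt ℝ n (fun y : E × (E →L[ℝ] ℝ) => A y.1) y := hA.fst'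
  have h₂ : ContDiffAt ℝ n (fun y : E × (E →L[ℝ] ℝ) =>
      (y.2 ∘L A y.1) ∘L ContinuousLinearMap.fst ℝ E (E →L[ℝ] ℝ)) y :=
    (contDiffAt_snd.clm_comp h₁).clm_comp contDiffAt_const
  exact (ContinuousAlternatingMap.ofSubsingletonLIE (𝕜 := ℝ) (E := E × (E →L[ℝ] ℝ)) (F := ℝ)
    (0 : Fin 1)).contDiff.contDiffAt.comp y h₂

theorem differentiableAt_coframeOneForm {A : E → E →L[ℝ] E} {y : E × (E →L[ℝ] ℝ)}
    (hA : ContDiffAt ℝ ∞ A y.1) : DifferentiableAt ℝ (coframeOneForm A) y :=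
  (contDiffAt_coframeOneForm hA).differentiableAt (by simp)

theorem differentiableAt_coframeTwoForm {A : E → E →L[ℝ] E} {y : E × (E →L[ℝ] ℝ)}
    (hA : ContDiffAt ℝ ∞ A y.1) : DifferentiableAt ℝ (coframeTwoForm A) y := by
  have h := differentiableAt_extDeriv (contDiffAt_coframeOneForm hA)
  exact DifferentiableAt.neg (𝕜 := ℝ) (F := (E × (E →L[ℝ] ℝ)) [⋀^Fin 2]→L[ℝ] ℝ) h

/-- `-d(ν ∘ A(x) ∘ dx)` evaluated on a pair of vectors. -/
theorem coframeTwoForm_apply {A : E → E →L[ℝ] E} {y : E × (E →L[ℝ] ℝ)}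
    (hA : DifferentiableAt ℝ A y.1) (v w : E × (E →L[ℝ] ℝ)) :
    coframeTwoForm A y ![v, w] =
      w.2 (A y.1 v.1) - v.2 (A y.1 w.1)
        - y.2 (fderiv ℝ A y.1 v.1 w.1) + y.2 (fderiv ℝ A y.1 w.1 v.1) := by
  have h₁ : HasFDerivAt (fun y : E × (E →L[ℝ] ℝ) => A y.1)
      ((fderiv ℝ A y.1) ∘L ContinuousLinearMap.fst ℝ E (E →L[ℝ] ℝ)) y :=
    hA.hasFDerivAt.comp y hasFDerivAt_fst
  have h₂ := ((hasFDerivAt_snd (𝕜 := ℝ) (p := y)).clm_comp h₁).clm_comp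
    (hasFDerivAt_const (ContinuousLinearMap.fst ℝ E (E →L[ℝ] ℝ)) y)
  have hd : DifferentiableAt ℝ (coframeOneForm A) y := by
    have h₃ := (ContinuousAlternatingMap.ofSubsingletonLIE (𝕜 := ℝ) (E := E × (E →L[ℝ] ℝ))
      (F := ℝ) (0 : Fin 1)).differentiable.differentiableAt.comp y h₂.differentiableAt
    exact h₃
  have key : ∀ a b : E × (E →L[ℝ] ℝ), fderiv ℝ (fun z => coframeOneForm A z ![a]) y b =
      b.2 (A y.1 a.1) + y.2 (fderiv ℝ A y.1 b.1 a.1) := by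
    intro a b
    have h₃ := h₂.clm_apply (hasFDerivAt_const a y)
    have : (fun z => coframeOneForm A z ![a]) = fun z : E × (E →L[ℝ] ℝ) =>
      ((z.2 ∘L A z.1) ∘L ContinuousLinearMap.fst ℝ E (E →L[ℝ] ℝ)) a := rfl
    rw [this, h₃.fderiv]
    simp [add_comm]
  have e₀ : Fin.removeNth (0 : Fin 2) ![v, w] = ![w] := by
    ext i <;> fin_cases i <;> rfl
  have e₁ : Fin.removeNth (1 : Fin 2) ![v, w] = ![v] := by
    ext i <;> fin_cases i <;> rfl
  rw [coframeTwoForm, ContinuousAlternatingMap.neg_apply, extDeriv_apply hd, Fin.sum_univ_two,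
    e₀, e₁]
  simp only [key, Matrix.cons_val_zero, Matrix.cons_val_one, Fin.val_zero, Fin.val_one, pow_zero,
    pow_one, one_smul, neg_smul]
  ring

/-- If `B` pulls back to `A` under `τ`, then the two-form of `B` pulls back to the two-form of `A`
under `τ × id`. -/
theorem coframeTwoForm_pullback {A B : E → E →L[ℝ] E} {τ : E → E} {y : E × (E →L[ℝ] ℝ)}
    (hB : ContDiffAt ℝ ∞ B (τ y.1)) (hτ : ContDiffAt ℝ ∞ τ y.1)
    (h : ∀ᶠ x in 𝓝 y.1, B (τ x) ∘L fderiv ℝ τ x = A x) :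
    (coframeTwoForm B (τ y.1, y.2)).compContinuousLinearMap
        ((fderiv ℝ τ y.1).prodMap (ContinuousLinearMap.id ℝ (E →L[ℝ] ℝ))) =
      coframeTwoForm A y := by
  set T : E × (E →L[ℝ] ℝ) → E × (E →L[ℝ] ℝ) := Prod.map τ id with hT
  have hTs : ContDiffAt ℝ ∞ T y := ContDiffAt.prodMap hτ contDiffAt_id
  have hev : ∀ᶠ z in 𝓝 y, DifferentiableAt ℝ τ z.1 ∧ B (τ z.1) ∘L fderiv ℝ τ z.1 = A z.1 :=
    continuous_fst.continuousAt.eventually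
      ((((hτ.of_le (m := 1) (by norm_cast)).eventually (by simp)).mono fun x hx =>
        hx.differentiableAt one_ne_zero).and h)
  have hfd : ∀ z : E × (E →L[ℝ] ℝ), DifferentiableAt ℝ τ z.1 →
      fderiv ℝ T z = (fderiv ℝ τ z.1).prodMap (ContinuousLinearMap.id ℝ (E →L[ℝ] ℝ)) := by
    intro z hz
    exact (HasFDerivAt.prodMap z hz.hasFDerivAt (hasFDerivAt_id z.2)).fderiv
  have hd : DifferentiableAt ℝ (coframeOneForm B) (T y) := differentiableAt_coframeOneForm hB
  have hpull := extDeriv_pullback hd hTs minSmoothness_real_two_le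
  have heq : (fun z => (coframeOneForm B (T z)).compContinuousLinearMap (fderiv ℝ T z))
      =ᶠ[𝓝 y] coframeOneForm A := by
    filter_upwards [hev] with z hz
    ext v
    rw [hfd z hz.1, coframeOneForm_apply, ← hz.2]
    rfl
  rw [heq.extDeriv_eq, hfd y hev.self_of_nhds.1] at hpull
  ext v
  have := congrArg (fun η => η v) hpull
  simp only [coframeTwoForm, ContinuousAlternatingMap.neg_apply] at this ⊢
  rw [this]
  rfl

/-- The two-form of the coframe `A` is the pullback of the canonical two-form of `T*E` under the
fibrewise linear map `(x, ν) ↦ (x, ν ∘ A(x))`. -/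
theorem coframeTwoForm_eq_pullback_canonical {A : E → E →L[ℝ] E} {y : E × (E →L[ℝ] ℝ)}
    (hA : ContDiffAt ℝ ∞ A y.1) :
    (coframeTwoForm (fun _ => ContinuousLinearMap.id ℝ E) (y.1, y.2 ∘L A y.1)
      ).compContinuousLinearMap (fderiv ℝ (fun z : E × (E →L[ℝ] ℝ) => (z.1, z.2 ∘L A z.1)) y) =
      coframeTwoForm A y := by
  set T : E × (E →L[ℝ] ℝ) → E × (E →L[ℝ] ℝ) := fun z => (z.1, z.2 ∘L A z.1) with hT
  have hTs : ContDiffAt ℝ ∞ T y := contDiffAt_fst.prodMk (contDiffAt_snd.clm_comp hA.fst')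
  have hd : DifferentiableAt ℝ (coframeOneForm fun _ : E => ContinuousLinearMap.id ℝ E) (T y) :=
    differentiableAt_coframeOneForm contDiffAt_const
  have hpull := extDeriv_pullback hd hTs minSmoothness_real_two_le
  have heq : (fun z => (coframeOneForm (fun _ => ContinuousLinearMap.id ℝ E)
      (T z)).compContinuousLinearMap (fderiv ℝ T z)) =ᶠ[𝓝 y] coframeOneForm A := by
    filter_upwards [(hTs.of_le (m := 1) (by norm_cast)).eventually (by simp)] with z hz
    ext v
    have h₁ : ∀ w, (fderiv ℝ T z w).1 = w.1 := by
      intro w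
      have hz' := (hz.differentiableAt one_ne_zero).hasFDerivAt
      have h₂ : HasFDerivAt (fun z => (T z).1)
        (ContinuousLinearMap.fst ℝ E (E →L[ℝ] ℝ) ∘L fderiv ℝ T z) z := hz'.fst
      have h₃ := h₂.unique (hasFDerivAt_fst (𝕜 := ℝ) (p := z))
      exact congrArg (fun L => L w) h₃
    change z.2 (A z.1 (fderiv ℝ T z (v 0)).1) = z.2 (A z.1 (v 0).1)
    rw [h₁]
  rw [heq.extDeriv_eq] at hpull
  ext v
  have := congrArg (fun η => η v) hpull
  simp only [coframeTwoForm, ContinuousAlternatingMap.neg_apply] at this ⊢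
  rw [this]
  rfl

variable [FiniteDimensional ℝ E]

/-- The two-form of a coframe is nondegenerate: pairing with `(0, ρ)` determines the first
component of a vector, and pairing with `(η, 0)` then determines the second. -/
theorem existsUnique_coframeTwoForm {A : E → E →L[ℝ] E} {y : E × (E →L[ℝ] ℝ)}
    (hA : DifferentiableAt ℝ A y.1) (hinj : Function.Injective (A y.1))
    (α : E × (E →L[ℝ] ℝ) →L[ℝ] ℝ) :
    ∃! v : E × (E →L[ℝ] ℝ), ∀ w, coframeTwoForm A y ![v, w] = α w := by
  have hsurj : Function.Surjective (A y.1) :=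
    LinearMap.surjective_of_injective (f := (A y.1 : E →ₗ[ℝ] E)) hinj
  let L : E × (E →L[ℝ] ℝ) →ₗ[ℝ] (E × (E →L[ℝ] ℝ) →ₗ[ℝ] ℝ) :=
    LinearMap.mk₂ ℝ (fun v w => w.2 (A y.1 v.1) - v.2 (A y.1 w.1)
        - y.2 (fderiv ℝ A y.1 v.1 w.1) + y.2 (fderiv ℝ A y.1 w.1 v.1))
      (by intros; simp; ring) (by intros; simp; ring) (by intros; simp; ring)
      (by intros; simp; ring)
  have hL : ∀ v w, coframeTwoForm A y ![v, w] = L v w := fun v w => coframeTwoForm_apply hA v w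
  -- a nonzero `a` is detected by `w = (0, ρ)` with `ρ` norming `A a`; then `b` by `w = (e, 0)`
  have hLinj : Function.Injective L := by
    rw [injective_iff_map_eq_zero]
    rintro ⟨a, b⟩ hv
    have h₀ : ∀ w : E × (E →L[ℝ] ℝ), w.2 (A y.1 a) - b (A y.1 w.1)
        - y.2 (fderiv ℝ A y.1 a w.1) + y.2 (fderiv ℝ A y.1 w.1 a) = 0 := fun w =>
      LinearMap.congr_fun hv w
    have ha : a = 0 := by
      have h₁ : A y.1 a = 0 := by
        by_contra hne
        obtain ⟨f, -, hf⟩ := exists_dual_vector ℝ (A y.1 a) (norm_ne_zero_iff.2 hne)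
        have := h₀ (0, f)
        simp only [map_zero, sub_zero, zero_apply, add_zero, hf] at this
        exact hne (norm_eq_zero.1 (by simpa using this))
      exact hinj (by rw [h₁, map_zero])
    subst ha
    have hb : b = 0 := by
      ext u
      obtain ⟨e, rfl⟩ := hsurj u
      simpa using h₀ (e, 0)
    rw [hb]
    rfl
  have hdim : Module.finrank ℝ (E × (E →L[ℝ] ℝ)) =
      Module.finrank ℝ (E × (E →L[ℝ] ℝ) →ₗ[ℝ] ℝ) := (Subspace.dual_finrank_eq).symm
  have hLsurj : Function.Surjective L :=
    (LinearMap.injective_iff_surjective_of_finrank_eq_finrank hdim).1 hLinj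
  obtain ⟨v, hv⟩ := hLsurj (α : E × (E →L[ℝ] ℝ) →ₗ[ℝ] ℝ)
  refine ⟨v, fun w => ?_, fun v' hv' => hLinj ?_⟩
  · rw [hL, hv]
    rfl
  · ext1
    all_goals
      ext w
      simp only [LinearMap.comp_apply]
      rw [← hL, hv', hv]
      rfl

end FrameForms

/-! ### Second derivatives at critical points and equilibria -/

section Calculus

variable {E F : Type*} [NormedAddCommGroup E] [NormedSpace ℝ E]
  [NormedAddCommGroup F] [NormedSpace ℝ F]

/-- At a critical point the second derivative transforms as a tensor. -/
theorem fderiv_fderiv_comp_of_critical {f : F → ℝ} {T : E → F} {y : E}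
    (hf : ContDiffAt ℝ ∞ f (T y)) (hT : ContDiffAt ℝ ∞ T y) (h₀ : fderiv ℝ f (T y) = 0) (v w : E) :
    fderiv ℝ (fderiv ℝ (f ∘ T)) y v w =
      fderiv ℝ (fderiv ℝ f) (T y) (fderiv ℝ T y v) (fderiv ℝ T y w) := by
  have hf' : DifferentiableAt ℝ (fderiv ℝ f) (T y) :=
    (hf.fderiv_right (m := 1) (by norm_cast)).differentiableAt one_ne_zero
  have hT' : DifferentiableAt ℝ (fderiv ℝ T) y :=
    (hT.fderiv_right (m := 1) (by norm_cast)).differentiableAt one_ne_zero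
  have hTd : DifferentiableAt ℝ T y := hT.differentiableAt (by simp)
  have heq : fderiv ℝ (f ∘ T) =ᶠ[𝓝 y] fun x => (fderiv ℝ f (T x)).comp (fderiv ℝ T x) := by
    filter_upwards [hT.continuousAt.eventually ((hf.of_le (m := 1) (by norm_cast)).eventually
      (by simp)), (hT.of_le (m := 1) (by norm_cast)).eventually (by simp)] with x h₁ h₂
    exact fderiv_comp x (h₁.differentiableAt one_ne_zero) (h₂.differentiableAt one_ne_zero)
  have h₁ := (hf'.hasFDerivAt.comp y hTd.hasFDerivAt).clm_comp hT'.hasFDerivAt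
  rw [heq.fderiv_eq, HasFDerivAt.fderiv (f := fun x => (fderiv ℝ f (T x)).comp (fderiv ℝ T x)) h₁]
  simp [h₀]

/-- The derivative at an equilibrium of a Hamiltonian vector field with respect to a variable
two-form: the term containing the derivative of the two-form vanishes there. -/
theorem apply_fderiv_of_hamiltonian {η : E → E [⋀^Fin 2]→L[ℝ] ℝ} {X : E → E} {f : E → ℝ} {y : E}
    (hη : DifferentiableAt ℝ η y) (hX : DifferentiableAt ℝ X y) (h₀ : X y = 0)
    (hf : ContDiffAt ℝ ∞ f y)
    (h : ∀ᶠ x in 𝓝 y, ∀ w, η x ![X x, w] = fderiv ℝ f x w) (v w : E) :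
    η y ![fderiv ℝ X y v, w] = fderiv ℝ (fderiv ℝ f) y v w := by
  have hf' : DifferentiableAt ℝ (fderiv ℝ f) y :=
    (hf.fderiv_right (m := 1) (by norm_cast)).differentiableAt one_ne_zero
  have hg : ∀ i, HasFDerivAt (fun x => ![X x, w] i) (![fderiv ℝ X y, (0 : E →L[ℝ] E)] i) y := by
    intro i
    fin_cases i
    · exact hX.hasFDerivAt
    · exact hasFDerivAt_const w y
  have h₁ := fderiv_continuousAlternatingMap_apply_apply hη (fun i => (hg i).differentiableAt) v
  have h₂ : HasFDerivAt (fun x => fderiv ℝ f x w) ((fderiv ℝ (fderiv ℝ f) y).flip w) y := by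
    simpa using hf'.hasFDerivAt.clm_apply (hasFDerivAt_const w y)
  have h₃ : (fun x => η x ![X x, w]) =ᶠ[𝓝 y] fun x => fderiv ℝ f x w := h.mono fun x hx => hx w
  have e₀ : ∀ ζ : E [⋀^Fin 2]→L[ℝ] ℝ, ζ ![(0 : E), w] = 0 := fun ζ =>
    ζ.map_coord_zero (0 : Fin 2) rfl
  have e₁ : η y ![0, 0] = 0 := (η y).map_coord_zero (0 : Fin 2) rfl
  have h₄ : fderiv ℝ (fun x => η x ![X x, w]) y v = fderiv ℝ (fderiv ℝ f) y v w := by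
    rw [h₃.fderiv_eq, h₂.fderiv]
    rfl
  have u₀ : Function.update (fun i => ![X y, w] i) 0 (fderiv ℝ X y v) = ![fderiv ℝ X y v, w] := by
    ext i
    fin_cases i <;> rfl
  have u₁ : Function.update (fun i => ![X y, w] i) 1 0 = ![(0 : E), 0] := by
    ext i
    fin_cases i
    · exact h₀
    · rfl
  have h₅ : fderiv ℝ η y v (fun i => ![X y, w] i) = 0 := by
    rw [h₀]
    exact e₀ _
  rw [Fin.sum_univ_two, (hg 0).fderiv, (hg 1).fderiv, h₅, zero_add] at h₁
  change _ = η y (Function.update (fun i => ![X y, w] i) 0 (fderiv ℝ X y v)) +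
    η y (Function.update (fun i => ![X y, w] i) 1 0) at h₁
  rw [u₀, u₁, e₁, add_zero] at h₁
  rw [← h₁]
  exact h₄

end Calculus

/-! ### Linearization of a flow on a vector space -/

section Flow

variable {E : Type*} [NormedAddCommGroup E] [NormedSpace ℝ E]
  {f : ℝ → E → E} {X : E → E} {y : E}

/-- A vector field with a smooth local flow is the initial velocity of the flow. -/
theorem eventuallyEq_initial_velocity
    (hf : ContDiffAt ℝ ∞ (fun p : ℝ × E => f p.1 p.2) (0, y))
    (hinit : ∀ᶠ x in 𝓝 y, f 0 x = x)
    (hcurve : ∀ᶠ p : ℝ × E in 𝓝 (0, y), HasDerivAt (fun t => f t p.2) (X (f p.1 p.2)) p.1) :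
    X =ᶠ[𝓝 y] fun x => fderiv ℝ (fun p : ℝ × E => f p.1 p.2) (0, x) (1, 0) := by
  have hc : Filter.Tendsto (fun x : E => ((0 : ℝ), x)) (𝓝 y) (𝓝 (0, y)) :=
    (Continuous.prodMk_right (0 : ℝ)).continuousAt
  filter_upwards [hinit, hc.eventually hcurve,
    hc.eventually ((hf.of_le (m := 1) (by norm_cast)).eventually (by simp))] with x h₁ h₂ h₃
  have h₄ := (h₃.differentiableAt one_ne_zero).hasFDerivAt.comp_hasDerivAt (0 : ℝ)
    ((hasDerivAt_id (0 : ℝ)).prodMk (hasDerivAt_const (0 : ℝ) x))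
  have h₅ := h₂.unique h₄
  rwa [h₁] at h₅

/-- A vector field is as regular as the time derivative of its flow; in particular it is `C¹`,
although no regularity of `X` is assumed. -/
theorem contDiffAt_of_flow
    (hf : ContDiffAt ℝ ∞ (fun p : ℝ × E => f p.1 p.2) (0, y))
    (hinit : ∀ᶠ x in 𝓝 y, f 0 x = x)
    (hcurve : ∀ᶠ p : ℝ × E in 𝓝 (0, y), HasDerivAt (fun t => f t p.2) (X (f p.1 p.2)) p.1) :
    ContDiffAt ℝ 1 X y := by
  have h₁ : ContDiffAt ℝ 1 (fderiv ℝ fun p : ℝ × E => f p.1 p.2) (0, y) :=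
    hf.fderiv_right (by norm_cast)
  have h₂ : ContDiffAt ℝ 1 (fun x : E => ((0 : ℝ), x)) y := contDiffAt_const.prodMk contDiffAt_id
  exact ((h₁.comp y h₂).clm_apply contDiffAt_const).congr_of_eventuallyEq
    (eventuallyEq_initial_velocity hf hinit hcurve)

/-- The flow of a vector field fixes an equilibrium. -/
theorem flow_eq_of_equilibrium
    (hf : ContDiffAt ℝ ∞ (fun p : ℝ × E => f p.1 p.2) (0, y))
    (hinit : ∀ᶠ x in 𝓝 y, f 0 x = x)
    (hcurve : ∀ᶠ p : ℝ × E in 𝓝 (0, y), HasDerivAt (fun t => f t p.2) (X (f p.1 p.2)) p.1)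
    (h₀ : X y = 0) : ∀ᶠ t in 𝓝 (0 : ℝ), f t y = y := by
  obtain ⟨K, s, hs, hK⟩ := (contDiffAt_of_flow hf hinit hcurve).exists_lipschitzOnWith
  have hc : Filter.Tendsto (fun t : ℝ => (t, y)) (𝓝 0) (𝓝 (0, y)) :=
    (Continuous.prodMk_left y).continuousAt
  have hfc : Filter.Tendsto (fun t : ℝ => f t y) (𝓝 0) (𝓝 y) := by
    have := hf.continuousAt.tendsto.comp hc
    simpa [Function.comp_def, hinit.self_of_nhds] using this
  refine ODE_solution_unique_of_eventually (v := fun _ => X) (s := fun _ => s) (K := K)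
    (g := fun _ => y) (Filter.Eventually.of_forall fun _ => hK)
    ((hc.eventually hcurve).and (hfc.eventually hs))
    (Filter.Eventually.of_forall fun t => ⟨?_, mem_of_mem_nhds hs⟩) hinit.self_of_nhds
  rw [h₀]
  exact hasDerivAt_const t y

/-- The time derivative of the tangent flow at `t = 0` is the derivative of the vector field, by the
symmetry of the second derivative of the flow. -/
theorem hasDerivAt_fderiv_flow
    (hf : ContDiffAt ℝ ∞ (fun p : ℝ × E => f p.1 p.2) (0, y))
    (hinit : ∀ᶠ x in 𝓝 y, f 0 x = x)
    (hcurve : ∀ᶠ p : ℝ × E in 𝓝 (0, y), HasDerivAt (fun t => f t p.2) (X (f p.1 p.2)) p.1)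
    (v : E) : HasDerivAt (fun t => fderiv ℝ (f t) y v) (fderiv ℝ X y v) 0 := by
  set g : ℝ × E → E := fun p => f p.1 p.2 with hg
  have hg' : DifferentiableAt ℝ (fderiv ℝ g) (0, y) :=
    (hf.fderiv_right (m := 1) (by norm_cast)).differentiableAt one_ne_zero
  have hc : Filter.Tendsto (fun t : ℝ => (t, y)) (𝓝 0) (𝓝 (0, y)) :=
    (Continuous.prodMk_left y).continuousAt
  have h₁ : (fun t => fderiv ℝ (f t) y v) =ᶠ[𝓝 0] fun t => fderiv ℝ g (t, y) (0, v) := by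
    filter_upwards [hc.eventually ((hf.of_le (m := 1) (by norm_cast)).eventually (by simp))]
      with t ht
    have h' : HasFDerivAt (f t) (fderiv ℝ g (t, y) ∘L ContinuousLinearMap.inr ℝ ℝ E) y :=
      HasFDerivAt.comp (g := g) y (ht.differentiableAt one_ne_zero).hasFDerivAt
        (hasFDerivAt_prodMk_right t y)
    rw [h'.fderiv]
    rfl
  have h₂ : HasDerivAt (fun t : ℝ => fderiv ℝ g (t, y) (0, v))
      (fderiv ℝ (fderiv ℝ g) (0, y) (1, 0) (0, v)) 0 := by
    have hline : HasDerivAt (fun t : ℝ => (t, y)) ((1 : ℝ), (0 : E)) 0 :=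
      (hasDerivAt_id (0 : ℝ)).prodMk (hasDerivAt_const (0 : ℝ) y)
    have hcomp : HasDerivAt (fun t : ℝ => fderiv ℝ g (t, y))
        (fderiv ℝ (fderiv ℝ g) (0, y) (1, 0)) 0 :=
      HasFDerivAt.comp_hasDerivAt (l := fderiv ℝ g) (0 : ℝ) hg'.hasFDerivAt hline
    simpa using hcomp.clm_apply (hasDerivAt_const (0 : ℝ) ((0 : ℝ), v))
  have h₃ : HasFDerivAt (fun x : E => fderiv ℝ g (0, x) (1, 0))
      (((fderiv ℝ (fderiv ℝ g) (0, y)).flip (1, 0)) ∘L ContinuousLinearMap.inr ℝ ℝ E) y := by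
    have := (HasFDerivAt.comp (g := fderiv ℝ g) y hg'.hasFDerivAt
      (hasFDerivAt_prodMk_right (0 : ℝ) y)).clm_apply (hasFDerivAt_const ((1 : ℝ), (0 : E)) y)
    refine this.congr_fderiv ?_
    ext w
    simp
  have h₄ : fderiv ℝ X y v = fderiv ℝ (fderiv ℝ g) (0, y) (0, v) (1, 0) := by
    rw [(eventuallyEq_initial_velocity hf hinit hcurve).fderiv_eq, h₃.fderiv]
    rfl
  have hsymm : IsSymmSndFDerivAt ℝ g (0, y) :=
    hf.isSymmSndFDerivAt minSmoothness_real_two_le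
  rw [h₄, hsymm.eq]
  exact h₂.congr_of_eventuallyEq h₁

end Flow

/-! ### Hamiltonian vectors -/

theorem compContinuousLinearMap_pair {V W : Type*} [AddCommGroup V] [Module ℝ V]
    [TopologicalSpace V] [AddCommGroup W] [Module ℝ W] [TopologicalSpace W]
    (Ω : W [⋀^Fin 2]→L[ℝ] ℝ) (D : V →L[ℝ] W) (u v : V) :
    Ω.compContinuousLinearMap D ![u, v] = Ω ![D u, D v] := by
  change Ω (D ∘ ![u, v]) = _
  congr 1
  ext i
  fin_cases i <;> rfl

section HamiltonianVector

variable {V : Type*} [AddCommGroup V] [Module ℝ V] [TopologicalSpace V]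
  {Ω : V [⋀^Fin 2]→L[ℝ] ℝ} {α : V →L[ℝ] ℝ}

theorem apply_hamiltonianVector (h : ∃! v : V, ∀ w : V, Ω ![v, w] = α w) (w : V) :
    Ω ![hamiltonianVector Ω α, w] = α w := by
  rw [hamiltonianVector, dif_pos h]
  exact h.choose_spec.1 w

theorem hamiltonianVector_eq (h : ∃! v : V, ∀ w : V, Ω ![v, w] = α w) {v : V}
    (hv : ∀ w, Ω ![v, w] = α w) : hamiltonianVector Ω α = v :=
  h.unique (apply_hamiltonianVector h) hv

end HamiltonianVector

/-! ### Linearization in charts -/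

section Charts

variable {E : Type*} [NormedAddCommGroup E] [NormedSpace ℝ E]
  {H : Type*} [TopologicalSpace H] (I : ModelWithCorners ℝ E H) [I.Boundaryless]
  {M : Type*} [TopologicalSpace M] [ChartedSpace H M]
  {E' : Type*} [NormedAddCommGroup E'] [NormedSpace ℝ E']
  {H' : Type*} [TopologicalSpace H'] (I' : ModelWithCorners ℝ E' H')
  {M' : Type*} [TopologicalSpace M'] [ChartedSpace H' M']

/-- The vector field `X` read in the preferred chart at `m`. -/
def chartVectorField (X : ∀ x : M, TangentSpace I x) (m : M) (y : E) : E :=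
  mfderiv I 𝓘(ℝ, E) (extChartAt I m) ((extChartAt I m).symm y) (X ((extChartAt I m).symm y))

theorem mfderiv_eq_fderiv_of_boundaryless {f : M → M'} {m : M} (hf : MDifferentiableAt I I' f m) :
    (mfderiv I I' f m : E →L[ℝ] E') =
      fderiv ℝ (extChartAt I' (f m) ∘ f ∘ (extChartAt I m).symm) (extChartAt I m m) := by
  rw [hf.mfderiv, writtenInExtChartAt, I.range_eq_univ, fderivWithin_univ]

variable [IsManifold I ∞ M]

theorem contMDiffAt_extChartAt_symm {m : M} {y : E} (hy : y ∈ (extChartAt I m).target) :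
    ContMDiffAt 𝓘(ℝ, E) I ∞ (extChartAt I m).symm y :=
  (contMDiffOn_extChartAt_symm m).contMDiffAt ((isOpen_extChartAt_target m).mem_nhds hy)

/-- A flow in the chart at an equilibrium reduces the linearization of a vector field to the
derivative of its chart representative. -/
theorem isLinearizationAt_of_fderiv_chart {X : ∀ x : M, TangentSpace I x} {m : M} (h₀ : X m = 0)
    {L : E → E}
    (hL : DifferentiableAt ℝ (chartVectorField I X m) (extChartAt I m m) →
      ∀ v, fderiv ℝ (chartVectorField I X m) (extChartAt I m m) v = L v) :
    IsLinearizationAt I X m L := by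
  refine ⟨h₀, fun F hF v => ?_⟩
  have hM : IsManifold I 1 M := IsManifold.of_le (n := ∞) (by norm_cast)
  set φ := extChartAt I m with hφ
  set y₀ := φ m with hy₀
  have hsymm : φ.symm y₀ = m := extChartAt_to_inv m
  have hF₀ : F 0 m = m := hF.initial.self_of_nhds
  have hy₀t : y₀ ∈ φ.target := mem_extChartAt_target m
  have hsymmc : Filter.Tendsto φ.symm (𝓝 y₀) (𝓝 m) := by
    have := (contMDiffAt_extChartAt_symm I hy₀t).continuousAt.tendsto
    rwa [hsymm] at this
  have hsrc : φ.source ∈ 𝓝 m := extChartAt_source_mem_nhds m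
  -- the flow read in the chart
  let f : ℝ → E → E := fun t y => φ (F t (φ.symm y))
  have hpair : Filter.Tendsto (fun p : ℝ × E => (p.1, φ.symm p.2)) (𝓝 (0, y₀)) (𝓝 (0, m)) := by
    rw [nhds_prod_eq, nhds_prod_eq]
    exact Filter.tendsto_id.prodMap hsymmc
  have hFc : Filter.Tendsto (fun p : ℝ × M => F p.1 p.2) (𝓝 (0, m)) (𝓝 m) := by
    have := hF.contMDiffAt.continuousAt.tendsto
    simpa only [hF₀] using this
  have hfs : ContDiffAt ℝ ∞ (fun p : ℝ × E => f p.1 p.2) (0, y₀) := by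
    rw [← contMDiffAt_iff_contDiffAt]
    have h₁ : ContMDiffAt 𝓘(ℝ, ℝ × E) (𝓘(ℝ, ℝ).prod I) ∞
        (fun p : ℝ × E => (p.1, φ.symm p.2)) (0, y₀) :=
      contDiff_fst.contMDiff.contMDiffAt.prodMk
        (ContMDiffAt.comp (g := φ.symm) (0, y₀) (contMDiffAt_extChartAt_symm I hy₀t)
          contDiff_snd.contMDiff.contMDiffAt)
    have h₂ : ContMDiffAt 𝓘(ℝ, ℝ × E) I ∞ (fun p : ℝ × E => F p.1 (φ.symm p.2)) (0, y₀) := by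
      refine ContMDiffAt.comp (g := fun p : ℝ × M => F p.1 p.2) (0, y₀) ?_ h₁
      simp only [hsymm]
      exact hF.contMDiffAt
    refine ContMDiffAt.comp (g := φ) (0, y₀) ?_ h₂
    simp only [hsymm, hF₀]
    exact contMDiffAt_extChartAt
  have hinit : ∀ᶠ y in 𝓝 y₀, f 0 y = y := by
    filter_upwards [hsymmc.eventually hF.initial, (isOpen_extChartAt_target m).mem_nhds hy₀t]
      with y h₁ h₂
    change φ (F 0 (φ.symm y)) = y
    rw [h₁]
    exact φ.right_inv h₂
  have hcurve : ∀ᶠ p : ℝ × E in 𝓝 (0, y₀),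
      HasDerivAt (fun t => f t p.2) (chartVectorField I X m (f p.1 p.2)) p.1 := by
    filter_upwards [hpair.eventually hF.integralCurve, hpair.eventually (hFc.eventually hsrc)]
      with p h₁ h₂
    have h₃ : HasMFDerivAt I 𝓘(ℝ, E) φ (F p.1 (φ.symm p.2))
        (mfderiv I 𝓘(ℝ, E) φ (F p.1 (φ.symm p.2))) :=
      (mdifferentiableAt_extChartAt (by rwa [← extChartAt_source I])).hasMFDerivAt
    -- name the derivative and the vector on the model space, forgetting the tangent spaces
    obtain ⟨D, hD⟩ : ∃ D : E →L[ℝ] E, D = mfderiv I 𝓘(ℝ, E) φ (F p.1 (φ.symm p.2)) := ⟨_, rfl⟩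
    obtain ⟨u, hu⟩ : ∃ u : E, u = X (F p.1 (φ.symm p.2)) := ⟨_, rfl⟩
    have h₄ : HasFDerivAt (fun t => f t p.2) (D ∘L ((1 : ℝ →L[ℝ] ℝ).smulRight u)) p.1 := by
      rw [hD, hu]
      exact (h₃.comp p.1 h₁).hasFDerivAt
    have h₅ : φ.symm (f p.1 p.2) = F p.1 (φ.symm p.2) := φ.left_inv h₂
    have h₆ : chartVectorField I X m (f p.1 p.2) = D u := by
      unfold chartVectorField
      rw [h₅, hD, hu]
      rfl
    rw [h₆]
    refine h₄.hasDerivAt.congr_deriv ?_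
    simp
  have hX₀ : chartVectorField I X m y₀ = 0 := by
    unfold chartVectorField
    rw [hsymm, h₀]
    exact map_zero _
  have hder := hasDerivAt_fderiv_flow hfs hinit hcurve v
  have hdiff : DifferentiableAt ℝ (chartVectorField I X m) y₀ :=
    (contDiffAt_of_flow hfs hinit hcurve).differentiableAt one_ne_zero
  rw [hL hdiff v] at hder
  have hline : Filter.Tendsto (fun t : ℝ => (t, m)) (𝓝 0) (𝓝 (0, m)) :=
    (Continuous.prodMk_left m).continuousAt
  have hFs : ContMDiffAt (𝓘(ℝ, ℝ).prod I) I 1 (fun p : ℝ × M => F p.1 p.2) (0, m) :=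
    hF.contMDiffAt.of_le (by norm_cast)
  refine hder.congr_of_eventuallyEq ?_
  filter_upwards [flow_eq_of_equilibrium hfs hinit hcurve hX₀,
    hline.eventually (hFc.eventually hsrc),
    hline.eventually ((contMDiffAt_iff_contMDiffAt_nhds (by simp)).1 hFs)]
    with t h₁ h₂ h₃
  -- `mfderiv` at `m` uses the preferred chart at `F t m`, which is the one at `m` as `F t m = m`
  have h₄ : F t m = m := by
    have h₅ : φ (F t m) = y₀ := by
      have h₆ : φ (F t (φ.symm y₀)) = y₀ := h₁
      rwa [hsymm] at h₆
    rw [← φ.left_inv h₂, h₅, hsymm]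
  have h₆ : MDifferentiableAt I I (F t) m := by
    have h₇ : ContMDiffAt I (𝓘(ℝ, ℝ).prod I) 1 (fun x : M => (t, x)) m :=
      contMDiffAt_const.prodMk contMDiffAt_id
    exact (ContMDiffAt.comp (g := fun p : ℝ × M => F p.1 p.2) m h₃ h₇).mdifferentiableAt
      one_ne_zero
  have h₈ := mfderiv_eq_fderiv_of_boundaryless I I h₆
  rw [h₄] at h₈
  exact congrArg (fun A : E →L[ℝ] E => A v) h₈

end Charts

/-! ### The Maurer–Cartan form in charts -/

section MaurerCartan

variable {E : Type*} [NormedAddCommGroup E] [NormedSpace ℝ E]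
  {H : Type*} [TopologicalSpace H] (I : ModelWithCorners ℝ E H)
  {G : Type*} [TopologicalSpace G] [ChartedSpace H G] [Group G]

/-- The left-invariant Maurer–Cartan form `T_k L_{k⁻¹} : T_k G → T_e G` read in the preferred chart
at `g₀`. -/
def maurerCartanInChart (g₀ : G) (x : E) : E →L[ℝ] E :=
  tangentLeftMul I ((extChartAt I g₀).symm x)⁻¹ ((extChartAt I g₀).symm x) ∘L
    (mfderiv 𝓘(ℝ, E) I (extChartAt I g₀).symm x : E →L[ℝ] E)

/-- The left translation by `k` read in the preferred charts at `g₀` and `g₁`. -/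
def leftMulInCharts (k g₀ g₁ : G) (x : E) : E :=
  extChartAt I g₁ (k * (extChartAt I g₀).symm x)

theorem tangentLeftMul_one (x : G) : tangentLeftMul I 1 x = ContinuousLinearMap.id ℝ E := by
  have h : (fun y : G => 1 * y) = id := by
    ext y
    simp
  unfold tangentLeftMul
  rw [h]
  exact mfderiv_id

variable [LieGroup I ∞ G]

theorem tangentLeftMul_comp (a b x : G) :
    tangentLeftMul I a (b * x) ∘L tangentLeftMul I b x = tangentLeftMul I (a * b) x := by
  have ha : MDifferentiableAt I I (fun y : G => a * y) (b * x) :=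
    (contMDiff_mul_left (I := I) (n := ∞)).contMDiffAt.mdifferentiableAt (by simp)
  have hb : MDifferentiableAt I I (fun y : G => b * y) x :=
    (contMDiff_mul_left (I := I) (n := ∞)).contMDiffAt.mdifferentiableAt (by simp)
  have h := mfderiv_comp x ha hb
  have h' : (fun y : G => a * y) ∘ (fun y : G => b * y) = fun y => a * b * y := by
    ext y
    simp [mul_assoc]
  rw [h'] at h
  exact h.symm

variable [I.Boundaryless]

theorem contMDiffAt_mul_extChartAt_symm (k : G) {g₀ : G} {x : E}
    (hx : x ∈ (extChartAt I g₀).target) :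
    ContMDiffAt 𝓘(ℝ, E) I ∞ (fun y => k * (extChartAt I g₀).symm y) x :=
  (contMDiff_mul_left (I := I) (n := ∞)).contMDiffAt.comp x (contMDiffAt_extChartAt_symm I hx)

/-- In a chart the Maurer–Cartan form is the partial derivative on the diagonal of the map
`(x, y) ↦ k(x)⁻¹ k(y)`, read in the chart at the identity. -/
theorem maurerCartanInChart_eq_fderiv {g₀ : G} {x : E} (hx : x ∈ (extChartAt I g₀).target) :
    maurerCartanInChart I g₀ x =
      fderiv ℝ (fun y => extChartAt I (1 : G)
        (((extChartAt I g₀).symm x)⁻¹ * (extChartAt I g₀).symm y)) x := by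
  set k := (extChartAt I g₀).symm x with hk
  have hd : MDifferentiableAt 𝓘(ℝ, E) I (fun y => k⁻¹ * (extChartAt I g₀).symm y) x :=
    (contMDiffAt_mul_extChartAt_symm I k⁻¹ hx).mdifferentiableAt (by simp)
  have h := mfderiv_eq_fderiv_of_boundaryless 𝓘(ℝ, E) I hd
  have h1 : k⁻¹ * (extChartAt I g₀).symm x = 1 := by rw [← hk, inv_mul_cancel]
  rw [h1] at h
  have h₂ := mfderiv_comp x (g := fun y : G => k⁻¹ * y) (f := (extChartAt I g₀).symm)
    ((contMDiff_mul_left (I := I) (n := ∞)).contMDiffAt.mdifferentiableAt (by simp))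
    ((contMDiffAt_extChartAt_symm I hx).mdifferentiableAt (by simp))
  have h₃ : maurerCartanInChart I g₀ x =
    (mfderiv 𝓘(ℝ, E) I (fun y => k⁻¹ * (extChartAt I g₀).symm y) x : E →L[ℝ] E) := h₂.symm
  rw [h₃, h]
  simp only [extChartAt_model_space_eq_id, PartialEquiv.refl_symm, PartialEquiv.refl_coe]
  rfl

/-- The description as a partial derivative of a smooth function of two variables gives
smoothness. -/
theorem contDiffAt_maurerCartanInChart {g₀ : G} {x₀ : E} (hx : x₀ ∈ (extChartAt I g₀).target) :
    ContDiffAt ℝ ∞ (maurerCartanInChart I g₀) x₀ := by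
  set ψ := extChartAt I g₀ with hψ
  have h₁ : ContDiffAt ℝ ∞ (Function.uncurry fun x y : E =>
      extChartAt I (1 : G) ((ψ.symm x)⁻¹ * ψ.symm y)) (x₀, x₀) := by
    rw [← contMDiffAt_iff_contDiffAt]
    have ha : ContMDiffAt 𝓘(ℝ, E × E) I ∞ (fun p : E × E => ψ.symm p.1) (x₀, x₀) :=
      ContMDiffAt.comp (g := ψ.symm) (x₀, x₀) (contMDiffAt_extChartAt_symm I hx)
        contDiff_fst.contMDiff.contMDiffAt
    have hb : ContMDiffAt 𝓘(ℝ, E × E) I ∞ (fun p : E × E => ψ.symm p.2) (x₀, x₀) :=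
      ContMDiffAt.comp (g := ψ.symm) (x₀, x₀) (contMDiffAt_extChartAt_symm I hx)
        contDiff_snd.contMDiff.contMDiffAt
    refine ContMDiffAt.comp (g := extChartAt I (1 : G)) (x₀, x₀) ?_ (ha.inv.mul hb)
    simp only [inv_mul_cancel]
    exact contMDiffAt_extChartAt
  have h₂ : ContDiffAt ℝ ∞ (fun x => fderiv ℝ (fun y =>
      extChartAt I (1 : G) ((ψ.symm x)⁻¹ * ψ.symm y)) x) x₀ :=
    ContDiffAt.fderiv (f := fun x y : E => extChartAt I (1 : G) ((ψ.symm x)⁻¹ * ψ.symm y))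
      (g := fun x => x) h₁ contDiffAt_id (by simp)
  refine h₂.congr_of_eventuallyEq ?_
  filter_upwards [(isOpen_extChartAt_target g₀).mem_nhds hx] with x hx'
  exact maurerCartanInChart_eq_fderiv I hx'

theorem contDiffAt_leftMulInCharts {k g₀ g₁ : G} {x : E} (hx : x ∈ (extChartAt I g₀).target)
    (hx' : k * (extChartAt I g₀).symm x ∈ (extChartAt I g₁).source) :
    ContDiffAt ℝ ∞ (leftMulInCharts I k g₀ g₁) x := by
  rw [← contMDiffAt_iff_contDiffAt]
  refine ContMDiffAt.comp (g := extChartAt I g₁) x ?_ (contMDiffAt_mul_extChartAt_symm I k hx)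
  exact contMDiffAt_extChartAt' (by rwa [← extChartAt_source I])

/-- Left translations preserve the Maurer–Cartan form. For `k = 1` this is the rule for a change of
charts. -/
theorem maurerCartanInChart_comp_fderiv {k g₀ g₁ : G} {x : E}
    (hx : x ∈ (extChartAt I g₀).target)
    (hx' : k * (extChartAt I g₀).symm x ∈ (extChartAt I g₁).source) :
    maurerCartanInChart I g₁ (leftMulInCharts I k g₀ g₁ x) ∘L
      fderiv ℝ (leftMulInCharts I k g₀ g₁) x = maurerCartanInChart I g₀ x := by
  set ψ₀ := extChartAt I g₀ with hψ₀
  set ψ₁ := extChartAt I g₁ with hψ₁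
  set q := ψ₀.symm x with hq
  have hτ := contDiffAt_leftMulInCharts I hx hx'
  have hinv : ψ₁.symm (leftMulInCharts I k g₀ g₁ x) = k * q := ψ₁.left_inv hx'
  have ht : leftMulInCharts I k g₀ g₁ x ∈ ψ₁.target := ψ₁.map_source hx'
  rw [maurerCartanInChart_eq_fderiv I hx, maurerCartanInChart_eq_fderiv I ht, hinv]
  have hd : DifferentiableAt ℝ (fun y => extChartAt I (1 : G) ((k * q)⁻¹ * ψ₁.symm y))
      (leftMulInCharts I k g₀ g₁ x) := by
    refine ContDiffAt.differentiableAt (n := ∞) ?_ (by simp)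
    rw [← contMDiffAt_iff_contDiffAt]
    refine ContMDiffAt.comp (g := extChartAt I (1 : G)) _ ?_
      (contMDiffAt_mul_extChartAt_symm I (k * q)⁻¹ ht)
    rw [hinv, inv_mul_cancel]
    exact contMDiffAt_extChartAt
  -- both sides are derivatives of `y ↦ (k q)⁻¹ (k q(y)) = q⁻¹ q(y)`
  have hc := fderiv_comp x hd (hτ.differentiableAt (by simp))
  rw [← hc]
  refine Filter.EventuallyEq.fderiv_eq ?_
  have hcont : ContinuousAt (fun y => k * ψ₀.symm y) x :=
    (contMDiffAt_mul_extChartAt_symm I k hx).continuousAt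
  filter_upwards [hcont.eventually ((isOpen_extChartAt_source g₁).mem_nhds hx')] with y hy
  have : ψ₁.symm (leftMulInCharts I k g₀ g₁ y) = k * ψ₀.symm y := ψ₁.left_inv hy
  simp only [Function.comp_apply, this]
  rw [mul_inv_rev, mul_assoc, inv_mul_cancel_left]

/-- The inverse of `T_k L_{k⁻¹}` is `T_e L_k`. -/
theorem isInvertible_maurerCartanInChart {g₀ : G} {x : E} (hx : x ∈ (extChartAt I g₀).target) :
    (maurerCartanInChart I g₀ x).IsInvertible := by
  have hM : IsManifold I 1 G := IsManifold.of_le (n := ∞) (by norm_cast)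
  set k := (extChartAt I g₀).symm x with hk
  have h₁ : (tangentLeftMul I k⁻¹ k).IsInvertible := by
    refine ContinuousLinearMap.IsInvertible.of_inverse (g := tangentLeftMul I k 1) ?_ ?_
    · have := tangentLeftMul_comp I k⁻¹ k 1
      rwa [mul_one, inv_mul_cancel, tangentLeftMul_one] at this
    · have := tangentLeftMul_comp I k k⁻¹ k
      rwa [inv_mul_cancel, mul_inv_cancel, tangentLeftMul_one] at this
  have h₂ : (mfderiv 𝓘(ℝ, E) I (extChartAt I g₀).symm x).IsInvertible := by
    have := isInvertible_mfderivWithin_extChartAt_symm (I := I) hx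
    rwa [I.range_eq_univ, mfderivWithin_univ] at this
  exact ContinuousLinearMap.IsInvertible.comp h₁ h₂

theorem maurerCartanInChart_one :
    maurerCartanInChart I (1 : G) (extChartAt I (1 : G) 1) = ContinuousLinearMap.id ℝ E := by
  have hM : IsManifold I 1 G := IsManifold.of_le (n := ∞) (by norm_cast)
  have h : (mfderiv 𝓘(ℝ, E) I (extChartAt I (1 : G)).symm (extChartAt I (1 : G) 1) : E →L[ℝ] E) =
      ContinuousLinearMap.id ℝ E := by
    have := mfderivWithin_range_extChartAt_symm (I := I) (x := (1 : G))
    rwa [I.range_eq_univ, mfderivWithin_univ] at this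
  rw [maurerCartanInChart, h, extChartAt_to_inv, inv_one, tangentLeftMul_one]
  rfl

end MaurerCartan

/-! ### The Maurer–Cartan equation at the identity -/

section LieBracket

variable {E : Type*} [NormedAddCommGroup E] [NormedSpace ℝ E]
  {H : Type*} [TopologicalSpace H] (I : ModelWithCorners ℝ E H) [I.Boundaryless]
  {G : Type*} [TopologicalSpace G] [ChartedSpace H G] [Group G] [LieGroup I ∞ G]

variable (G) in
/-- The bracket of the Lie algebra `T_e G`, on the model space `E` underlying `T_e G`. -/
def modelBracket (a b : E) : E :=
  (⁅(show GroupLieAlgebra I G from a), (show GroupLieAlgebra I G from b)⁆ : GroupLieAlgebra I G)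

/-- The Maurer–Cartan form is constant on left-invariant vector fields. -/
theorem maurerCartanInChart_apply_mulInvariantVectorField (a : GroupLieAlgebra I G) {x : E}
    (hx : x ∈ (extChartAt I (1 : G)).target) :
    maurerCartanInChart I (1 : G) x (VectorField.mpullbackWithin 𝓘(ℝ, E) I
      (extChartAt I (1 : G)).symm (mulInvariantVectorField a) (Set.range I) x) = a := by
  have hM : IsManifold I 1 G := IsManifold.of_le (n := ∞) (by norm_cast)
  set k := (extChartAt I (1 : G)).symm x with hk
  have hinv : (mfderiv 𝓘(ℝ, E) I (extChartAt I (1 : G)).symm x).IsInvertible := by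
    have := isInvertible_mfderivWithin_extChartAt_symm (I := I) hx
    rwa [I.range_eq_univ, mfderivWithin_univ] at this
  rw [VectorField.mpullbackWithin_apply, I.range_eq_univ, mfderivWithin_univ]
  have h₁ := congrArg (fun A => A (mulInvariantVectorField a k)) hinv.self_comp_inverse
  have h₂ := congrArg (fun A => A a) (tangentLeftMul_comp I k⁻¹ k 1)
  rw [inv_mul_cancel, tangentLeftMul_one, mul_one] at h₂
  change tangentLeftMul I k⁻¹ k (mfderiv 𝓘(ℝ, E) I (extChartAt I (1 : G)).symm x
    ((mfderiv 𝓘(ℝ, E) I (extChartAt I (1 : G)).symm x).inverse (mulInvariantVectorField a k))) = a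
  change mfderiv 𝓘(ℝ, E) I (extChartAt I (1 : G)).symm x
    ((mfderiv 𝓘(ℝ, E) I (extChartAt I (1 : G)).symm x).inverse (mulInvariantVectorField a k)) =
    mulInvariantVectorField a k at h₁
  rw [h₁]
  exact h₂

/-- The Maurer–Cartan equation at the identity. -/
theorem fderiv_maurerCartanInChart_sub [FiniteDimensional ℝ E] (a b : E) :
    fderiv ℝ (maurerCartanInChart I (1 : G)) (extChartAt I (1 : G) 1) a b -
      fderiv ℝ (maurerCartanInChart I (1 : G)) (extChartAt I (1 : G) 1) b a =
      -modelBracket I G a b := by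
  have hM : IsManifold I 1 G := IsManifold.of_le (n := ∞) (by norm_cast)
  have : CompleteSpace E := FiniteDimensional.complete ℝ E
  set A := maurerCartanInChart I (1 : G) with hA
  set x₀ := extChartAt I (1 : G) 1 with hx₀
  have hx₀t : x₀ ∈ (extChartAt I (1 : G)).target := mem_extChartAt_target 1
  -- the left-invariant vector field with value `c` at the identity, read in the chart
  let W : E → E → E := fun c => VectorField.mpullbackWithin 𝓘(ℝ, E) I (extChartAt I (1 : G)).symm
    (mulInvariantVectorField (c : GroupLieAlgebra I G)) (Set.range I)
  have hW : ∀ c : E, ∀ᶠ x in 𝓝 x₀, A x (W c x) = c := fun c => by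
    filter_upwards [(isOpen_extChartAt_target (1 : G)).mem_nhds hx₀t] with x hx
    exact maurerCartanInChart_apply_mulInvariantVectorField I c hx
  -- at the identity the Maurer–Cartan form is the identity map
  have hW₀ : ∀ c : E, W c x₀ = c := fun c => by
    have := (hW c).self_of_nhds
    rwa [hA, maurerCartanInChart_one] at this
  have hAd : DifferentiableAt ℝ A x₀ :=
    (contDiffAt_maurerCartanInChart I hx₀t).differentiableAt (by simp)
  have hWd : ∀ c : E, DifferentiableAt ℝ (W c) x₀ := fun c => by
    have h₁ : ContDiffAt ℝ 1 (fun x => (A x).inverse) x₀ :=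
      (isInvertible_maurerCartanInChart I hx₀t).contDiffAt_map_inverse.comp x₀
        ((contDiffAt_maurerCartanInChart I hx₀t).of_le (by norm_cast))
    have h₂ : DifferentiableAt ℝ (fun x => (A x).inverse c) x₀ :=
      (h₁.differentiableAt one_ne_zero).clm_apply (differentiableAt_const c)
    refine h₂.congr_of_eventuallyEq ?_
    filter_upwards [hW c, (isOpen_extChartAt_target (1 : G)).mem_nhds hx₀t] with x hx hxt
    exact (((isInvertible_maurerCartanInChart I hxt).inverse_apply_eq).2 hx.symm).symm
  -- differentiate the identity `A (W c) = c`
  have hder : ∀ c v : E, fderiv ℝ A x₀ v c = -fderiv ℝ (W c) x₀ v := fun c v => by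
    have h₁ := (hAd.hasFDerivAt.clm_apply (hWd c).hasFDerivAt).fderiv
    have h₂ : (fun x => A x (W c x)) =ᶠ[𝓝 x₀] fun _ => c := hW c
    rw [h₂.fderiv_eq] at h₁
    have h₃ := congrArg (fun L => L v) h₁
    have h₄ : A x₀ = ContinuousLinearMap.id ℝ E := maurerCartanInChart_one I
    simp only [hW₀, h₄] at h₃
    simp at h₃
    rw [eq_neg_iff_add_eq_zero, add_comm]
    exact h₃.symm
  have hbr : modelBracket I G a b = fderiv ℝ (W b) x₀ a - fderiv ℝ (W a) x₀ b := by
    have h₁ : VectorField.lieBracketWithin ℝ (W a) (W b)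
        ((extChartAt I (1 : G)).symm ⁻¹' Set.univ ∩ Set.range I) x₀ =
        fderiv ℝ (W b) x₀ a - fderiv ℝ (W a) x₀ b := by
      rw [Set.preimage_univ, Set.univ_inter, I.range_eq_univ, VectorField.lieBracketWithin_univ,
        VectorField.lieBracket_eq]
      simp only [hW₀]
    have h₂ : ∀ D : E →L[ℝ] E, D = ContinuousLinearMap.id ℝ E → ∀ u : E, D.inverse u = u := by
      rintro D rfl u
      rw [ContinuousLinearMap.inverse_id]
      rfl
    rw [← h₁]
    exact h₂ _ mfderiv_extChartAt_self _
  rw [hbr, hder, hder]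
  abel

end LieBracket

/-! ### The Liouville form in bundle charts -/

section Liouville

variable {E : Type*} [NormedAddCommGroup E] [NormedSpace ℝ E]
  {H : Type*} [TopologicalSpace H] (I : ModelWithCorners ℝ E H) [I.Boundaryless]
  {M : Type*} [TopologicalSpace M] [ChartedSpace H M] [IsManifold I ∞ M]

/-- A bundle chart of `T*M` composes a covector with the derivative of the inverse chart of `M`. -/
theorem extChartAt_cotangentBundle_apply (α β : CotangentBundle I M)
    (hβ : β.proj ∈ (chartAt H α.proj).source) :
    extChartAt (I.prod 𝓘(ℝ, E →L[ℝ] ℝ)) α β = (extChartAt I α.proj β.proj,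
      ((β.2 : E →L[ℝ] ℝ) ∘L
        (mfderiv 𝓘(ℝ, E) I (extChartAt I α.proj).symm (extChartAt I α.proj β.proj) :
          E →L[ℝ] E))) := by
  have h := TangentBundle.symmL_trivializationAt (I := I) hβ
  rw [I.range_eq_univ, mfderivWithin_univ] at h
  rw [FiberBundle.extChartAt, ← h]
  refine Prod.ext rfl ?_
  ext v
  change Bundle.Trivialization.continuousLinearMapAt ℝ (Bundle.Trivial.trivialization M ℝ) β.proj
    _ = _
  rw [Bundle.Trivial.continuousLinearMapAt_trivialization]
  rfl

/-- In the bundle chart at `α`, the Liouville form of `T*M` is the Liouville form of `T*E`. -/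
theorem canonicalOneForm_in_chart (α : CotangentBundle I M) {y : E × (E →L[ℝ] ℝ)}
    (hy : y ∈ (extChartAt (I.prod 𝓘(ℝ, E →L[ℝ] ℝ)) α).target) :
    (canonicalOneForm I M ((extChartAt (I.prod 𝓘(ℝ, E →L[ℝ] ℝ)) α).symm y)
      ).compContinuousLinearMap (mfderiv 𝓘(ℝ, E × (E →L[ℝ] ℝ)) (I.prod 𝓘(ℝ, E →L[ℝ] ℝ))
        (extChartAt (I.prod 𝓘(ℝ, E →L[ℝ] ℝ)) α).symm y) =
      coframeOneForm (fun _ => ContinuousLinearMap.id ℝ E) y := by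
  set K := extChartAt (I.prod 𝓘(ℝ, E →L[ℝ] ℝ)) α with hK
  set ψ := extChartAt I α.proj with hψ
  have hsrc : ∀ z ∈ K.target, (K.symm z).proj ∈ (chartAt H α.proj).source := by
    intro z hz
    have h₁ : K.symm z ∈ K.source := K.map_target hz
    rw [hK, FiberBundle.extChartAt] at h₁
    have h₂ : (K.symm z).proj ∈ (extChartAt I α.proj).source := h₁.2.1
    rwa [extChartAt_source] at h₂
  have hproj : ∀ z ∈ K.target, (K.symm z).proj = ψ.symm z.1 := by
    intro z hz
    have h₁ := congrArg Prod.fst (extChartAt_cotangentBundle_apply I α (K.symm z) (hsrc z hz))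
    rw [← hK, K.right_inv hz] at h₁
    change z.1 = ψ (K.symm z).proj at h₁
    rw [h₁, ψ.left_inv (by rw [hψ, extChartAt_source]; exact hsrc z hz)]
  have hzt : y.1 ∈ ψ.target := by
    have h₁ := hy
    rw [hK, FiberBundle.extChartAt_target] at h₁
    exact h₁.1.1
  have hd₁ : MDifferentiableAt (I.prod 𝓘(ℝ, E →L[ℝ] ℝ)) I
      (fun β : CotangentBundle I M => β.proj) (K.symm y) :=
    (Bundle.contMDiff_proj (n := 1) (IB := I)
      (fun x : M => TangentSpace I x →L[ℝ] Bundle.Trivial M ℝ x)).contMDiffAt.mdifferentiableAt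
      one_ne_zero
  have hd₂ : MDifferentiableAt 𝓘(ℝ, E × (E →L[ℝ] ℝ)) (I.prod 𝓘(ℝ, E →L[ℝ] ℝ)) K.symm y :=
    (contMDiffAt_extChartAt_symm (I.prod 𝓘(ℝ, E →L[ℝ] ℝ)) hy).mdifferentiableAt (by simp)
  have hc := mfderiv_comp y hd₁ hd₂
  have heq : (fun β : CotangentBundle I M => β.proj) ∘ K.symm =ᶠ[𝓝 y] ψ.symm ∘ Prod.fst := by
    filter_upwards [(isOpen_extChartAt_target α).mem_nhds hy] with z hz
    exact hproj z hz
  have hd₃ : MDifferentiableAt 𝓘(ℝ, E) I ψ.symm y.1 :=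
    (contMDiffAt_extChartAt_symm I hzt).mdifferentiableAt (by simp)
  have hfst : MDifferentiableAt 𝓘(ℝ, E × (E →L[ℝ] ℝ)) 𝓘(ℝ, E)
      (Prod.fst : E × (E →L[ℝ] ℝ) → E) y := differentiableAt_fst.mdifferentiableAt
  rw [heq.mfderiv_eq, mfderiv_comp y hd₃ hfst, mfderiv_eq_fderiv, fderiv_fst] at hc
  have h₂ := congrArg Prod.snd (extChartAt_cotangentBundle_apply I α (K.symm y) (hsrc y hy))
  rw [← hK, K.right_inv hy, ← hψ, hproj y hy, ψ.right_inv hzt] at h₂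
  ext v
  have h₃ := congrArg (fun L => L (v 0)) hc
  have h₄ := congrArg (fun L => L (v 0).1) h₂
  have h₅ : ((K.symm y).2 : E →L[ℝ] ℝ) ((mfderiv (I.prod 𝓘(ℝ, E →L[ℝ] ℝ)) I
      (fun β : CotangentBundle I M => β.proj) (K.symm y) ∘L mfderiv 𝓘(ℝ, E × (E →L[ℝ] ℝ))
        (I.prod 𝓘(ℝ, E →L[ℝ] ℝ)) K.symm y) (v 0)) = y.2 (v 0).1 :=
    (congrArg ((K.symm y).2 : E →L[ℝ] ℝ) h₃.symm).trans h₄.symm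
  exact h₅

end Liouville

/-! ### The canonical symplectic form in bundle charts -/

section CanonicalForm

variable {E : Type*} [NormedAddCommGroup E] [NormedSpace ℝ E]
  {H : Type*} [TopologicalSpace H] (I : ModelWithCorners ℝ E H) [I.Boundaryless]
  {M : Type*} [TopologicalSpace M] [ChartedSpace H M] [IsManifold I ∞ M]

/-- In the bundle chart at `α`, the canonical symplectic form of `T*M` at `α` is that of `T*E`. -/
theorem canonicalSymplecticForm_eq (α : CotangentBundle I M) :
    canonicalSymplecticForm I M α = coframeTwoForm (fun _ => ContinuousLinearMap.id ℝ E)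
      (extChartAt (I.prod 𝓘(ℝ, E →L[ℝ] ℝ)) α α) := by
  set K := extChartAt (I.prod 𝓘(ℝ, E →L[ℝ] ℝ)) α with hK
  let η : E × (E →L[ℝ] ℝ) → (E × (E →L[ℝ] ℝ)) [⋀^Fin 1]→L[ℝ] ℝ := fun y =>
    (canonicalOneForm I M (K.symm y)).compContinuousLinearMap
      (mfderiv 𝓘(ℝ, E × (E →L[ℝ] ℝ)) (I.prod 𝓘(ℝ, E →L[ℝ] ℝ)) K.symm y)
  have heq : η =ᶠ[𝓝 (K α)] coframeOneForm fun _ => ContinuousLinearMap.id ℝ E := by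
    filter_upwards [(isOpen_extChartAt_target α).mem_nhds (mem_extChartAt_target α)] with y hy
    exact canonicalOneForm_in_chart I α hy
  have hid : (mfderiv (I.prod 𝓘(ℝ, E →L[ℝ] ℝ)) 𝓘(ℝ, E × (E →L[ℝ] ℝ)) K α :
      E × (E →L[ℝ] ℝ) →L[ℝ] E × (E →L[ℝ] ℝ)) = ContinuousLinearMap.id ℝ _ :=
    mfderiv_extChartAt_self
  have h₁ : canonicalSymplecticForm I M α = -((extDeriv η (K α)).compContinuousLinearMap
      (mfderiv (I.prod 𝓘(ℝ, E →L[ℝ] ℝ)) 𝓘(ℝ, E × (E →L[ℝ] ℝ)) K α :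
      E × (E →L[ℝ] ℝ) →L[ℝ] E × (E →L[ℝ] ℝ))) := rfl
  rw [h₁, hid, heq.extDeriv_eq]
  rfl

end CanonicalForm

/-! ### The symplectic form in body coordinates -/

section BodyCoordinates

variable {E : Type*} [NormedAddCommGroup E] [NormedSpace ℝ E]
  {H : Type*} [TopologicalSpace H] (I : ModelWithCorners ℝ E H)
  {G : Type*} [TopologicalSpace G] [ChartedSpace H G] [Group G]

/-- The chart on the factor `𝔤*` is the identity, so that of `G × 𝔤*` is a chart of `G` times it. -/
theorem extChartAt_bodyModel_apply (z z' : G × LieAlgebraDual I G) :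
    extChartAt (bodyModel I G) z z' = (extChartAt I z.1 z'.1, z'.2) := by
  rw [extChartAt_prod]
  rfl

theorem extChartAt_bodyModel_symm_apply (z : G × LieAlgebraDual I G) (y : E × (E →L[ℝ] ℝ)) :
    (extChartAt (bodyModel I G) z).symm y = ((extChartAt I z.1).symm y.1, y.2) := by
  rw [extChartAt_prod]
  rfl

theorem mem_extChartAt_bodyModel_target {z : G × LieAlgebraDual I G} {y : E × (E →L[ℝ] ℝ)} :
    y ∈ (extChartAt (bodyModel I G) z).target ↔ y.1 ∈ (extChartAt I z.1).target := by
  rw [extChartAt_prod]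
  exact ⟨fun h => h.1, fun h => ⟨h, by rw [extChartAt_model_space_eq_id]; exact Set.mem_univ _⟩⟩

theorem mem_extChartAt_bodyModel_source {z z' : G × LieAlgebraDual I G} :
    z' ∈ (extChartAt (bodyModel I G) z).source ↔ z'.1 ∈ (extChartAt I z.1).source := by
  rw [extChartAt_prod]
  exact ⟨fun h => h.1, fun h => ⟨h, by rw [extChartAt_model_space_eq_id]; exact Set.mem_univ _⟩⟩

/-- The two-form of the Maurer–Cartan coframe at the centre of the preferred chart at `z`, on the
model space `E × E*` underlying `T_z (G × 𝔤*)`. -/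
def bodyChartForm (z : G × LieAlgebraDual I G) : (E × (E →L[ℝ] ℝ)) [⋀^Fin 2]→L[ℝ] ℝ :=
  coframeTwoForm (maurerCartanInChart I z.1) (extChartAt I z.1 z.1, z.2)

variable [I.Boundaryless] [LieGroup I ∞ G]

/-- The inverse of the left trivialization, read in a bundle chart of `T*G`. -/
theorem extChartAt_bodyCoordinatesInv {g : G} (α : CotangentBundle I G) (hα : α.proj = g)
    {z : G × LieAlgebraDual I G} (hz : z.1 ∈ (extChartAt I g).source) :
    extChartAt (I.prod 𝓘(ℝ, E →L[ℝ] ℝ)) α (bodyCoordinatesInv I z) =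
      (extChartAt I g z.1, z.2 ∘L maurerCartanInChart I g (extChartAt I g z.1)) := by
  subst hα
  have hsrc : (bodyCoordinatesInv I z).proj ∈ (chartAt H α.proj).source := by
    rwa [← extChartAt_source I]
  rw [extChartAt_cotangentBundle_apply I α _ hsrc]
  refine Prod.ext rfl ?_
  unfold maurerCartanInChart
  rw [(extChartAt I α.proj).left_inv hz]
  rfl

/-- Smoothness of the inverse left trivialization makes its `mfderiv` in the definition of the body
symplectic form the true derivative. -/
theorem contMDiffAt_bodyCoordinatesInv (z : G × LieAlgebraDual I G) :
    ContMDiffAt (bodyModel I G) (I.prod 𝓘(ℝ, E →L[ℝ] ℝ)) ∞ (bodyCoordinatesInv I) z := by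
  have hc : ContinuousAt (Prod.fst : G × LieAlgebraDual I G → G) z := continuousAt_fst
  rw [Bundle.contMDiffAt_totalSpace]
  refine ⟨contMDiffAt_fst, ?_⟩
  have h₁ : ContMDiffAt (bodyModel I G) 𝓘(ℝ, E →L[ℝ] E) ∞
      (fun z' : G × LieAlgebraDual I G => maurerCartanInChart I z.1 (extChartAt I z.1 z'.1)) z := by
    refine ContMDiffAt.comp (g := maurerCartanInChart I z.1) z
      (contDiffAt_maurerCartanInChart I (mem_extChartAt_target z.1)).contMDiffAt ?_
    exact ContMDiffAt.comp (g := extChartAt I z.1) z contMDiffAt_extChartAt contMDiffAt_fst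
  have h₂ : ContMDiffAt (bodyModel I G) 𝓘(ℝ, E →L[ℝ] ℝ) ∞
      (fun z' : G × LieAlgebraDual I G =>
        z'.2 ∘L maurerCartanInChart I z.1 (extChartAt I z.1 z'.1)) z :=
    contMDiffAt_snd.clm_comp h₁
  refine h₂.congr_of_eventuallyEq ?_
  filter_upwards [hc.eventually (extChartAt_source_mem_nhds (I := I) z.1)] with z' hz'
  have h₃ := congrArg Prod.snd (extChartAt_bodyCoordinatesInv I (bodyCoordinatesInv I z) rfl hz')
  rw [FiberBundle.extChartAt] at h₃
  exact h₃

/-- In the preferred chart at `z`, the body symplectic form at `z` is the two-form of the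
Maurer–Cartan coframe. -/
theorem bodySymplecticForm_eq (z : G × LieAlgebraDual I G) :
    bodySymplecticForm I z = bodyChartForm I z := by
  unfold bodyChartForm
  have hz : extChartAt I z.1 z.1 ∈ (extChartAt I z.1).target := mem_extChartAt_target z.1
  have hA := contDiffAt_maurerCartanInChart I hz
  rw [← coframeTwoForm_eq_pullback_canonical (y := (extChartAt I z.1 z.1, z.2)) hA]
  unfold bodySymplecticForm
  rw [canonicalSymplecticForm_eq, extChartAt_bodyCoordinatesInv I (bodyCoordinatesInv I z) rfl
    (mem_extChartAt_source z.1)]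
  have hd := (contMDiffAt_bodyCoordinatesInv I z).mdifferentiableAt (by simp)
  have h₁ := mfderiv_eq_fderiv_of_boundaryless (bodyModel I G) (I.prod 𝓘(ℝ, E →L[ℝ] ℝ)) hd
  rw [extChartAt_bodyModel_apply] at h₁
  have h₂ : extChartAt (I.prod 𝓘(ℝ, E →L[ℝ] ℝ)) (bodyCoordinatesInv I z) ∘
      bodyCoordinatesInv I ∘ (extChartAt (bodyModel I G) z).symm
      =ᶠ[𝓝 (extChartAt I z.1 z.1, z.2)] fun y : E × (E →L[ℝ] ℝ) =>
        (y.1, y.2 ∘L maurerCartanInChart I z.1 y.1) := by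
    have hc : ContinuousAt (Prod.fst : E × (E →L[ℝ] ℝ) → E) (extChartAt I z.1 z.1, z.2) :=
      continuousAt_fst
    filter_upwards [hc.eventually ((isOpen_extChartAt_target z.1).mem_nhds hz)] with y hy
    have h₃ : (extChartAt I z.1).symm y.1 ∈ (extChartAt I z.1).source :=
      (extChartAt I z.1).map_target hy
    simp only [Function.comp_apply, extChartAt_bodyModel_symm_apply]
    rw [extChartAt_bodyCoordinatesInv I (g := z.1) (z := ((extChartAt I z.1).symm y.1, y.2))
      (bodyCoordinatesInv I z) rfl h₃,
      (extChartAt I z.1).right_inv hy]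
  rw [h₂.fderiv_eq] at h₁
  rw [← h₁]
  rfl

end BodyCoordinates

/-! ### Invariance, nondegeneracy and Hamilton's equations -/

section BodyHamiltonian

variable {E : Type*} [NormedAddCommGroup E] [NormedSpace ℝ E]
  {H : Type*} [TopologicalSpace H] (I : ModelWithCorners ℝ E H)
  {G : Type*} [TopologicalSpace G] [ChartedSpace H G] [Group G]

/-- The lifted left translation read in charts. -/
theorem extChartAt_comp_mul_comp_symm (k : G) (z z₁ : G × LieAlgebraDual I G) :
    extChartAt (bodyModel I G) z₁ ∘ (fun z' : G × LieAlgebraDual I G => (k * z'.1, z'.2)) ∘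
      (extChartAt (bodyModel I G) z).symm =
      (Prod.map (leftMulInCharts I k z.1 z₁.1) id :
        E × LieAlgebraDual I G → E × LieAlgebraDual I G) := by
  ext1 y
  simp only [Function.comp_apply, extChartAt_bodyModel_symm_apply, extChartAt_bodyModel_apply]
  rfl

theorem mfderiv_eq_fderiv_chart [I.Boundaryless] {h : G × LieAlgebraDual I G → ℝ}
    (hh : ContMDiff (bodyModel I G) 𝓘(ℝ, ℝ) ∞ h) (z : G × LieAlgebraDual I G) :
    (mfderiv (bodyModel I G) 𝓘(ℝ, ℝ) h z : E × LieAlgebraDual I G →L[ℝ] ℝ) =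
      fderiv ℝ (h ∘ (extChartAt (bodyModel I G) z).symm) (extChartAt (bodyModel I G) z z) := by
  rw [mfderiv_eq_fderiv_of_boundaryless (bodyModel I G) 𝓘(ℝ, ℝ)
    (hh.contMDiffAt.mdifferentiableAt (by simp)), extChartAt_model_space_eq_id]
  rfl

variable [LieGroup I ∞ G]

/-- The covector part does not change, since `T_e L_{k x} = T L_k ∘ T_e L_x`: in body coordinates
the lifted left translation acts on `G` only. -/
theorem bodyAction_apply (k : G) (z : G × LieAlgebraDual I G) :
    bodyAction I k z = (k * z.1, z.2) := by
  refine Prod.ext rfl ?_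
  have h₁ := tangentLeftMul_comp I k⁻¹ (k * z.1) 1
  rw [mul_one, inv_mul_cancel_left] at h₁
  have h₂ := tangentLeftMul_comp I z.1⁻¹ z.1 1
  rw [mul_one, inv_mul_cancel, tangentLeftMul_one] at h₂
  change ((z.2 ∘L tangentLeftMul I z.1⁻¹ z.1) ∘L tangentLeftMul I k⁻¹ (k * z.1)) ∘L
    tangentLeftMul I (k * z.1) 1 = z.2
  rw [ContinuousLinearMap.comp_assoc, h₁, ContinuousLinearMap.comp_assoc, h₂]
  rfl

variable [I.Boundaryless]

theorem hasFDerivAt_prodMap_leftMulInCharts {k : G} {g₀ g₁ : G} {y : E × (E →L[ℝ] ℝ)}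
    (hy : y.1 ∈ (extChartAt I g₀).target)
    (hy' : k * (extChartAt I g₀).symm y.1 ∈ (extChartAt I g₁).source) :
    HasFDerivAt (Prod.map (leftMulInCharts I k g₀ g₁) id : E × (E →L[ℝ] ℝ) → E × (E →L[ℝ] ℝ))
      ((fderiv ℝ (leftMulInCharts I k g₀ g₁) y.1).prodMap
        (ContinuousLinearMap.id ℝ (E →L[ℝ] ℝ))) y :=
  HasFDerivAt.prodMap y
    ((contDiffAt_leftMulInCharts I hy hy').differentiableAt (by simp)).hasFDerivAt
    (hasFDerivAt_id y.2)

/-- The two-form of the Maurer–Cartan coframe is invariant under left translations and under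
changes of charts. -/
theorem coframeTwoForm_maurerCartan_pullback {k : G} {g₀ g₁ : G} {y : E × (E →L[ℝ] ℝ)}
    (hy : y.1 ∈ (extChartAt I g₀).target)
    (hy' : k * (extChartAt I g₀).symm y.1 ∈ (extChartAt I g₁).source) :
    (coframeTwoForm (maurerCartanInChart I g₁)
      (leftMulInCharts I k g₀ g₁ y.1, y.2)).compContinuousLinearMap
        ((fderiv ℝ (leftMulInCharts I k g₀ g₁) y.1).prodMap
          (ContinuousLinearMap.id ℝ (E →L[ℝ] ℝ))) =
      coframeTwoForm (maurerCartanInChart I g₀) y := by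
  refine coframeTwoForm_pullback
    (contDiffAt_maurerCartanInChart I ((extChartAt I g₁).map_source hy'))
    (contDiffAt_leftMulInCharts I hy hy') ?_
  have hc : ContinuousAt (fun x => k * (extChartAt I g₀).symm x) y.1 :=
    (contMDiffAt_mul_extChartAt_symm I k hy).continuousAt
  filter_upwards [(isOpen_extChartAt_target g₀).mem_nhds hy,
    hc.eventually ((isOpen_extChartAt_source g₁).mem_nhds hy')] with x hx hx'
  exact maurerCartanInChart_comp_fderiv I hx hx'

/-- A change of charts is the left translation by `1` read in two charts. -/
theorem mfderiv_extChartAt_bodyModel {z₀ z : G × LieAlgebraDual I G}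
    (hz : z.1 ∈ (extChartAt I z₀.1).source) :
    (mfderiv (bodyModel I G) 𝓘(ℝ, E × LieAlgebraDual I G) (extChartAt (bodyModel I G) z₀) z :
      E × LieAlgebraDual I G →L[ℝ] E × LieAlgebraDual I G) =
      (fderiv ℝ (leftMulInCharts I 1 z.1 z₀.1) (extChartAt I z.1 z.1)).prodMap
        (ContinuousLinearMap.id ℝ (E →L[ℝ] ℝ)) := by
  have hM : IsManifold (bodyModel I G) 1 (G × LieAlgebraDual I G) :=
    IsManifold.of_le (n := ∞) (by norm_cast)
  have hd : MDifferentiableAt (bodyModel I G) 𝓘(ℝ, E × LieAlgebraDual I G)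
      (extChartAt (bodyModel I G) z₀) z :=
    mdifferentiableAt_extChartAt (by
      rw [← extChartAt_source (bodyModel I G)]
      exact (mem_extChartAt_bodyModel_source I).2 hz)
  have h₁ := mfderiv_eq_fderiv_of_boundaryless (bodyModel I G) 𝓘(ℝ, E × LieAlgebraDual I G) hd
  have h₂ := extChartAt_comp_mul_comp_symm I (1 : G) z z₀
  simp only [one_mul] at h₂
  rw [extChartAt_model_space_eq_id, extChartAt_bodyModel_apply] at h₁
  rw [h₁]
  have h₃ := hasFDerivAt_prodMap_leftMulInCharts I (k := 1) (g₀ := z.1) (g₁ := z₀.1)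
    (y := (extChartAt I z.1 z.1, z.2)) (mem_extChartAt_target z.1)
    (by rwa [one_mul, extChartAt_to_inv])
  rw [← h₃.fderiv, ← h₂]
  rfl

theorem contDiffAt_comp_extChartAt_symm {h : G × LieAlgebraDual I G → ℝ}
    (hh : ContMDiff (bodyModel I G) 𝓘(ℝ, ℝ) ∞ h) (z : G × LieAlgebraDual I G)
    {y : E × LieAlgebraDual I G} (hy : y ∈ (extChartAt (bodyModel I G) z).target) :
    ContDiffAt ℝ ∞ (h ∘ (extChartAt (bodyModel I G) z).symm) y :=
  (hh.contMDiffAt.comp y (contMDiffAt_extChartAt_symm (bodyModel I G) hy)).contDiffAt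

theorem bodyHamiltonianVectorField_eq (h : G × LieAlgebraDual I G → ℝ)
    (z : G × LieAlgebraDual I G) :
    bodyHamiltonianVectorField I h z = hamiltonianVector (bodyChartForm I z)
      (mfderiv (bodyModel I G) 𝓘(ℝ, ℝ) h z : E × (E →L[ℝ] ℝ) →L[ℝ] ℝ) := by
  unfold bodyHamiltonianVectorField hamiltonianVectorField
  rw [bodySymplecticForm_eq]
  rfl

variable [FiniteDimensional ℝ E]

theorem existsUnique_bodyChartForm (z : G × LieAlgebraDual I G)
    (α : E × (E →L[ℝ] ℝ) →L[ℝ] ℝ) :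
    ∃! v : E × (E →L[ℝ] ℝ), ∀ w, bodyChartForm I z ![v, w] = α w := by
  have hz := mem_extChartAt_target (I := I) z.1
  exact existsUnique_coframeTwoForm
    ((contDiffAt_maurerCartanInChart I hz).differentiableAt (by simp))
    (isInvertible_maurerCartanInChart I hz).injective α

/-- Nondegeneracy, in the form in which identities between vectors are checked. -/
theorem eq_of_bodyChartForm_eq {z : G × LieAlgebraDual I G} {v v' : E × (E →L[ℝ] ℝ)}
    (h : ∀ w, bodyChartForm I z ![v, w] = bodyChartForm I z ![v', w]) : v = v' := by
  let α : E × (E →L[ℝ] ℝ) →L[ℝ] ℝ :=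
    (bodyChartForm I z).toContinuousMultilinearMap.toContinuousLinearMap ![v, 0] 1
  have hα : ∀ w, α w = bodyChartForm I z ![v, w] := fun w => by
    change bodyChartForm I z (Function.update ![v, 0] 1 w) = _
    congr 1
    ext i <;> fin_cases i <;> rfl
  exact (existsUnique_bodyChartForm I z α).unique (fun w => (hα w).symm)
    fun w => (h w).symm.trans (hα w).symm

theorem bodyHamiltonianVectorField_spec (h : G × LieAlgebraDual I G → ℝ)
    (z : G × LieAlgebraDual I G) (w : E × (E →L[ℝ] ℝ)) :
    bodyChartForm I z ![(bodyHamiltonianVectorField I h z : E × (E →L[ℝ] ℝ)), w] =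
      (mfderiv (bodyModel I G) 𝓘(ℝ, ℝ) h z : E × (E →L[ℝ] ℝ) →L[ℝ] ℝ) w := by
  rw [bodyHamiltonianVectorField_eq]
  exact apply_hamiltonianVector (existsUnique_bodyChartForm I z _) w

/-- By nondegeneracy the equilibria of `X_h` are the critical points of `h`. -/
theorem bodyHamiltonianVectorField_eq_zero_iff (h : G × LieAlgebraDual I G → ℝ)
    (z : G × LieAlgebraDual I G) :
    bodyHamiltonianVectorField I h z = 0 ↔
      (mfderiv (bodyModel I G) 𝓘(ℝ, ℝ) h z : E × (E →L[ℝ] ℝ) →L[ℝ] ℝ) = 0 := by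
  have h₀ : ∀ w : E × (E →L[ℝ] ℝ), bodyChartForm I z ![(0 : E × (E →L[ℝ] ℝ)), w] = 0 :=
    fun w => (bodyChartForm I z).map_coord_zero (0 : Fin 2) rfl
  constructor
  · intro hX
    ext1 w
    rw [← bodyHamiltonianVectorField_spec I h z w, hX]
    exact h₀ w
  · intro hd
    rw [bodyHamiltonianVectorField_eq]
    refine hamiltonianVector_eq (existsUnique_bodyChartForm I z _) fun w => ?_
    rw [hd]
    exact h₀ w

/-- Hamilton's equations in a chart of `G × 𝔤*`. -/
theorem coframeTwoForm_chartVectorField {h : G × LieAlgebraDual I G → ℝ}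
    (hh : ContMDiff (bodyModel I G) 𝓘(ℝ, ℝ) ∞ h) (z₀ : G × LieAlgebraDual I G)
    {y : E × LieAlgebraDual I G} (hy : y ∈ (extChartAt (bodyModel I G) z₀).target)
    (w : E × LieAlgebraDual I G) :
    coframeTwoForm (maurerCartanInChart I z₀.1) y
      ![chartVectorField (bodyModel I G) (bodyHamiltonianVectorField I h) z₀ y, w] =
      fderiv ℝ (h ∘ (extChartAt (bodyModel I G) z₀).symm) y w := by
  have hM : IsManifold (bodyModel I G) 1 (G × LieAlgebraDual I G) :=
    IsManifold.of_le (n := ∞) (by norm_cast)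
  set Ψ := extChartAt (bodyModel I G) z₀ with hΨ
  obtain ⟨z, hz⟩ : ∃ z, z = Ψ.symm y := ⟨_, rfl⟩
  have hzs : z.1 ∈ (extChartAt I z₀.1).source := by
    rw [← mem_extChartAt_bodyModel_source I, hz]
    exact Ψ.map_target hy
  have hy₂ : y = (leftMulInCharts I 1 z.1 z₀.1 (extChartAt I z.1 z.1), z.2) := by
    have h₁ : Ψ z = y := by rw [hz, Ψ.right_inv hy]
    rw [← h₁, hΨ, extChartAt_bodyModel_apply]
    simp [leftMulInCharts]
  -- `D` and `S` are the derivatives of the chart at `z₀` and of its inverse, on the model space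
  obtain ⟨D, hD⟩ : ∃ D : E × LieAlgebraDual I G →L[ℝ] E × LieAlgebraDual I G,
    D = mfderiv (bodyModel I G) 𝓘(ℝ, E × LieAlgebraDual I G) Ψ z := ⟨_, rfl⟩
  obtain ⟨S, hS⟩ : ∃ S : E × LieAlgebraDual I G →L[ℝ] E × LieAlgebraDual I G,
    S = mfderiv 𝓘(ℝ, E × LieAlgebraDual I G) (bodyModel I G) Ψ.symm y := ⟨_, rfl⟩
  obtain ⟨u, hu⟩ : ∃ u : E × LieAlgebraDual I G, u = bodyHamiltonianVectorField I h z := ⟨_, rfl⟩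
  have hDS : ∀ w, D (S w) = w := by
    have h₁ := mfderiv_extChartAt_comp_mfderivWithin_extChartAt_symm (I := bodyModel I G)
      (x := z₀) hy
    rw [(bodyModel I G).range_eq_univ, mfderivWithin_univ, ← hΨ, ← hz] at h₁
    intro w
    rw [hD, hS]
    exact congrArg (fun L => L w) h₁
  have hX : chartVectorField (bodyModel I G) (bodyHamiltonianVectorField I h) z₀ y = D u := by
    rw [hD, hu, hz]
    rfl
  have hchain : fderiv ℝ (h ∘ Ψ.symm) y =
      (mfderiv (bodyModel I G) 𝓘(ℝ, ℝ) h z : E × LieAlgebraDual I G →L[ℝ] ℝ) ∘L S := by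
    rw [← mfderiv_eq_fderiv, mfderiv_comp y (hh.contMDiffAt.mdifferentiableAt (by simp))
      ((contMDiffAt_extChartAt_symm (bodyModel I G) hy).mdifferentiableAt (by simp)), hS, hz]
    rfl
  have hpull := coframeTwoForm_maurerCartan_pullback I (k := 1) (g₀ := z.1) (g₁ := z₀.1)
    (y := (extChartAt I z.1 z.1, z.2)) (mem_extChartAt_target z.1)
    (by rwa [one_mul, extChartAt_to_inv])
  rw [← mfderiv_extChartAt_bodyModel I hzs, ← hΨ, ← hD, ← hy₂] at hpull
  have hspec := bodyHamiltonianVectorField_spec I h z (S w)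
  unfold bodyChartForm at hspec
  rw [← hpull, ← hu, compContinuousLinearMap_pair, hDS] at hspec
  rw [hX, hchain]
  exact hspec

end BodyHamiltonian

/-! ### The linear Hamiltonian vector field at an equilibrium -/

section LinearHamiltonian

variable {E : Type*} [NormedAddCommGroup E] [NormedSpace ℝ E]
  {H : Type*} [TopologicalSpace H] (I : ModelWithCorners ℝ E H) [I.Boundaryless]
  {G : Type*} [TopologicalSpace G] [ChartedSpace H G] [Group G] [LieGroup I ∞ G]

theorem isSymmSndFDerivAt_chart {h : G × LieAlgebraDual I G → ℝ}
    (hh : ContMDiff (bodyModel I G) 𝓘(ℝ, ℝ) ∞ h) (z : G × LieAlgebraDual I G) :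
    IsSymmSndFDerivAt ℝ (h ∘ (extChartAt (bodyModel I G) z).symm)
      (extChartAt (bodyModel I G) z z) :=
  (contDiffAt_comp_extChartAt_symm I hh z (mem_extChartAt_target z)).isSymmSndFDerivAt
    minSmoothness_real_two_le

/-- The differential of `Q(v) = ½ d²h(v, v)` is `d²h(v, ·)`. -/
theorem fderiv_bodyQuadraticForm {h : G × LieAlgebraDual I G → ℝ}
    (hh : ContMDiff (bodyModel I G) 𝓘(ℝ, ℝ) ∞ h) (z : G × LieAlgebraDual I G)
    (v : E × LieAlgebraDual I G) :
    fderiv ℝ (bodyQuadraticForm I h z) v =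
      fderiv ℝ (fderiv ℝ (h ∘ (extChartAt (bodyModel I G) z).symm))
        (extChartAt (bodyModel I G) z z) v := by
  have hsymm := isSymmSndFDerivAt_chart I hh z
  set B := fderiv ℝ (fderiv ℝ (h ∘ (extChartAt (bodyModel I G) z).symm))
    (extChartAt (bodyModel I G) z z) with hB
  have h₁ : HasFDerivAt (fun u : E × LieAlgebraDual I G => (1 / 2 : ℝ) * B u u)
      ((1 / 2 : ℝ) • (B v + B.flip v)) v := by
    refine ((B.hasFDerivAt.clm_apply (hasFDerivAt_id v)).const_mul (1 / 2 : ℝ)).congr_fderiv ?_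
    ext w <;> simp
  have h₂ : B.flip v = B v := ContinuousLinearMap.ext fun w => hsymm.eq w v
  rw [h₂] at h₁
  have h₃ : fderiv ℝ (bodyQuadraticForm I h z) v = _ := h₁.fderiv
  rw [h₃, ← two_smul ℝ, smul_smul]
  norm_num

variable [FiniteDimensional ℝ E]

/-- The defining equation `ω_B(X_Q(v), w) = d²h(v, w)`. -/
theorem bodyLinearHamiltonianVectorField_spec {h : G × LieAlgebraDual I G → ℝ}
    (hh : ContMDiff (bodyModel I G) 𝓘(ℝ, ℝ) ∞ h) (z : G × LieAlgebraDual I G)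
    (v w : E × (E →L[ℝ] ℝ)) :
    bodyChartForm I z ![bodyLinearHamiltonianVectorField I h z v, w] =
      hessianAt (bodyModel I G) h z v w := by
  have h₁ : bodyLinearHamiltonianVectorField I h z v = hamiltonianVector (bodyChartForm I z)
      (fderiv ℝ (bodyQuadraticForm I h z) v) := by
    unfold bodyLinearHamiltonianVectorField linearHamiltonianVectorField
    rw [bodySymplecticForm_eq]
  rw [h₁, apply_hamiltonianVector (existsUnique_bodyChartForm I z _),
    fderiv_bodyQuadraticForm I hh]
  rfl

theorem isLinearMap_bodyLinearHamiltonianVectorField {h : G × LieAlgebraDual I G → ℝ}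
    (hh : ContMDiff (bodyModel I G) 𝓘(ℝ, ℝ) ∞ h) (z : G × LieAlgebraDual I G) :
    IsLinearMap ℝ (bodyLinearHamiltonianVectorField I h z) := by
  have hadd : ∀ u v w : E × (E →L[ℝ] ℝ), bodyChartForm I z ![u + v, w] =
      bodyChartForm I z ![u, w] + bodyChartForm I z ![v, w] := fun u v w =>
    (bodyChartForm I z).vecCons_add ![w] u v
  have hsmul : ∀ (c : ℝ) (u w : E × (E →L[ℝ] ℝ)), bodyChartForm I z ![c • u, w] =
      c * bodyChartForm I z ![u, w] := fun c u w =>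
    (bodyChartForm I z).vecCons_smul ![w] c u
  refine ⟨fun u v => eq_of_bodyChartForm_eq I (z := z) fun w => ?_,
    fun c u => eq_of_bodyChartForm_eq I (z := z) fun w => ?_⟩
  · rw [hadd]
    simp only [bodyLinearHamiltonianVectorField_spec I hh]
    simp [hessianAt]
  · rw [hsmul]
    simp only [bodyLinearHamiltonianVectorField_spec I hh]
    simp [hessianAt]

/-- The linear Hamiltonian vector field of `½ d²h` is the linearization of `X_h` at an
equilibrium. -/
theorem isLinearizationAt_bodyHamiltonianVectorField {h : G × LieAlgebraDual I G → ℝ}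
    (hh : ContMDiff (bodyModel I G) 𝓘(ℝ, ℝ) ∞ h) {z : G × LieAlgebraDual I G}
    (h₀ : bodyHamiltonianVectorField I h z = 0) :
    IsLinearizationAt (bodyModel I G) (bodyHamiltonianVectorField I h) z
      (bodyLinearHamiltonianVectorField I h z) := by
  refine isLinearizationAt_of_fderiv_chart (bodyModel I G) h₀ fun hX v =>
    eq_of_bodyChartForm_eq I (z := z) fun w => ?_
  rw [bodyLinearHamiltonianVectorField_spec I hh]
  have ht := mem_extChartAt_target (I := bodyModel I G) z
  have hy : extChartAt (bodyModel I G) z z = (extChartAt I z.1 z.1, z.2) :=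
    extChartAt_bodyModel_apply I z z
  have hη : DifferentiableAt ℝ (coframeTwoForm (maurerCartanInChart I z.1))
      (extChartAt (bodyModel I G) z z) :=
    differentiableAt_coframeTwoForm
      (contDiffAt_maurerCartanInChart I ((mem_extChartAt_bodyModel_target I).1 ht))
  have hX₀ : chartVectorField (bodyModel I G) (bodyHamiltonianVectorField I h) z
      (extChartAt (bodyModel I G) z z) = 0 := by
    unfold chartVectorField
    rw [extChartAt_to_inv, h₀]
    exact map_zero _
  have hev : ∀ᶠ y in 𝓝 (extChartAt (bodyModel I G) z z), ∀ w,
      coframeTwoForm (maurerCartanInChart I z.1) y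
        ![chartVectorField (bodyModel I G) (bodyHamiltonianVectorField I h) z y, w] =
        fderiv ℝ (h ∘ (extChartAt (bodyModel I G) z).symm) y w := by
    filter_upwards [(isOpen_extChartAt_target z).mem_nhds ht] with y hy' w
    exact coframeTwoForm_chartVectorField I hh z hy' w
  have := apply_fderiv_of_hamiltonian hη hX hX₀ (contDiffAt_comp_extChartAt_symm I hh z ht)
    hev v w
  unfold bodyChartForm
  rw [← hy]
  exact this

end LinearHamiltonian

/-! ### Translation of an equilibrium to the identity -/

section Translation

variable {E : Type*} [NormedAddCommGroup E] [NormedSpace ℝ E]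
  {H : Type*} [TopologicalSpace H] (I : ModelWithCorners ℝ E H)
  {G : Type*} [TopologicalSpace G] [ChartedSpace H G] [Group G] [LieGroup I ∞ G]

theorem contMDiff_bodyAction (g : G) :
    ContMDiff (bodyModel I G) (bodyModel I G) ∞ (bodyAction I g) := by
  have h : bodyAction I g = fun z : G × LieAlgebraDual I G => (g * z.1, z.2) :=
    funext (bodyAction_apply I g)
  rw [h]
  exact ((contMDiff_mul_left (I := I) (n := ∞) (a := g)).comp contMDiff_fst).prodMk contMDiff_snd

variable [I.Boundaryless]

/-- In charts `Φ_g` is the derivative of the left translation on `𝔤` and the identity on `𝔤*`. -/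
theorem bodyActionTangent_eq (g : G) (μ : LieAlgebraDual I G) :
    bodyActionTangent I g μ =
      (fderiv ℝ (leftMulInCharts I g 1 g) (extChartAt I (1 : G) 1)).prodMap
        (ContinuousLinearMap.id ℝ (E →L[ℝ] ℝ)) := by
  have hd := (contMDiff_bodyAction I g).contMDiffAt (x := ((1 : G), μ)) |>.mdifferentiableAt
    (by simp)
  have h₁ := mfderiv_eq_fderiv_of_boundaryless (bodyModel I G) (bodyModel I G) hd
  have h₂ : bodyAction I g = fun z : G × LieAlgebraDual I G => (g * z.1, z.2) :=
    funext (bodyAction_apply I g)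
  rw [bodyAction_apply, extChartAt_bodyModel_apply, mul_one, h₂,
    extChartAt_comp_mul_comp_symm] at h₁
  have h₃ := hasFDerivAt_prodMap_leftMulInCharts I (k := g) (g₀ := 1) (g₁ := g)
    (y := (extChartAt I (1 : G) 1, μ)) (mem_extChartAt_target 1)
    (by rw [extChartAt_to_inv, mul_one]; exact mem_extChartAt_source g)
  unfold bodyActionTangent
  rw [h₂]
  exact h₁.trans h₃.fderiv

/-- The tangent map of the lifted left translation is symplectic. -/
theorem bodyChartForm_bodyActionTangent (g : G) (μ : LieAlgebraDual I G)
    (v w : E × (E →L[ℝ] ℝ)) :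
    bodyChartForm I (g, μ) ![bodyActionTangent I g μ v, bodyActionTangent I g μ w] =
      bodyChartForm I ((1 : G), μ) ![v, w] := by
  have h := coframeTwoForm_maurerCartan_pullback I (k := g) (g₀ := 1) (g₁ := g)
    (y := (extChartAt I (1 : G) 1, μ)) (mem_extChartAt_target 1)
    (by rw [extChartAt_to_inv, mul_one]; exact mem_extChartAt_source g)
  have h₁ : leftMulInCharts I g 1 g (extChartAt I (1 : G) 1) = extChartAt I g g := by
    rw [leftMulInCharts, extChartAt_to_inv, mul_one]
  rw [← bodyActionTangent_eq I g μ] at h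
  simp only [h₁] at h
  have h₂ := congrArg (fun Ω => Ω ![v, w]) h
  simp only [compContinuousLinearMap_pair] at h₂
  exact h₂

/-- A symplectic linear map is injective, hence surjective in finite dimension. -/
theorem bodyActionTangent_surjective [FiniteDimensional ℝ E] (g : G) (μ : LieAlgebraDual I G) :
    Function.Surjective (bodyActionTangent I g μ) := by
  refine LinearMap.surjective_of_injective
    (f := (bodyActionTangent I g μ : E × (E →L[ℝ] ℝ) →ₗ[ℝ] E × (E →L[ℝ] ℝ))) fun v v' h => ?_
  refine eq_of_bodyChartForm_eq I (z := ((1 : G), μ)) fun w => ?_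
  rw [← bodyChartForm_bodyActionTangent I g μ v w, ← bodyChartForm_bodyActionTangent I g μ v' w]
  have h' : bodyActionTangent I g μ v = bodyActionTangent I g μ v' := h
  rw [h']

/-- The Hessian at a critical point is carried along by the lifted left translation. -/
theorem hessianAt_comp_bodyAction {h : G × LieAlgebraDual I G → ℝ}
    (hh : ContMDiff (bodyModel I G) 𝓘(ℝ, ℝ) ∞ h) (g : G) (μ : LieAlgebraDual I G)
    (hcrit : (mfderiv (bodyModel I G) 𝓘(ℝ, ℝ) h (g, μ) : E × (E →L[ℝ] ℝ) →L[ℝ] ℝ) = 0)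
    (v w : E × (E →L[ℝ] ℝ)) :
    hessianAt (bodyModel I G) (h ∘ bodyAction I g) ((1 : G), μ) v w =
      hessianAt (bodyModel I G) h (g, μ) (bodyActionTangent I g μ v)
        (bodyActionTangent I g μ w) := by
  have hx : extChartAt I (1 : G) 1 ∈ (extChartAt I (1 : G)).target := mem_extChartAt_target 1
  have hx' : g * (extChartAt I (1 : G)).symm (extChartAt I (1 : G) 1) ∈
      (extChartAt I g).source := by
    rw [extChartAt_to_inv, mul_one]
    exact mem_extChartAt_source g
  set y : E × (E →L[ℝ] ℝ) := (extChartAt I (1 : G) 1, μ) with hy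
  let T : E × (E →L[ℝ] ℝ) → E × (E →L[ℝ] ℝ) := Prod.map (leftMulInCharts I g 1 g) id
  have hTy : T y = extChartAt (bodyModel I G) (g, μ) (g, μ) := by
    rw [extChartAt_bodyModel_apply]
    change (leftMulInCharts I g 1 g (extChartAt I (1 : G) 1), μ) = _
    rw [leftMulInCharts, extChartAt_to_inv, mul_one]
  have hTs : ContDiffAt ℝ ∞ T y :=
    ContDiffAt.prodMap (contDiffAt_leftMulInCharts I hx hx') contDiffAt_id
  have hTd : fderiv ℝ T y = bodyActionTangent I g μ := by
    rw [bodyActionTangent_eq]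
    exact (hasFDerivAt_prodMap_leftMulInCharts I (y := y) hx hx').fderiv
  have heq : (h ∘ bodyAction I g) ∘ (extChartAt (bodyModel I G) ((1 : G), μ)).symm =ᶠ[𝓝 y]
      (h ∘ (extChartAt (bodyModel I G) (g, μ)).symm) ∘ T := by
    have hc : ContinuousAt (fun p : E × (E →L[ℝ] ℝ) => g * (extChartAt I (1 : G)).symm p.1) y :=
      ContinuousAt.comp (g := fun x => g * (extChartAt I (1 : G)).symm x)
        (contMDiffAt_mul_extChartAt_symm I g hx).continuousAt continuousAt_fst
    filter_upwards [hc.eventually ((isOpen_extChartAt_source g).mem_nhds hx')] with p hp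
    have h₁ : (extChartAt I g).symm (leftMulInCharts I g 1 g p.1) =
        g * (extChartAt I (1 : G)).symm p.1 := (extChartAt I g).left_inv hp
    simp only [Function.comp_apply, extChartAt_bodyModel_symm_apply, bodyAction_apply]
    change _ = h ((extChartAt I g).symm (leftMulInCharts I g 1 g p.1), p.2)
    rw [h₁]
  have hf : ContDiffAt ℝ ∞ (h ∘ (extChartAt (bodyModel I G) (g, μ)).symm) (T y) := by
    rw [hTy]
    exact contDiffAt_comp_extChartAt_symm I hh (g, μ) (mem_extChartAt_target _)
  have hf₀ : fderiv ℝ (h ∘ (extChartAt (bodyModel I G) (g, μ)).symm) (T y) = 0 := by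
    rw [hTy, ← mfderiv_eq_fderiv_chart I hh]
    exact hcrit
  have key := fderiv_fderiv_comp_of_critical hf hTs hf₀ v w
  rw [hTd, hTy] at key
  unfold hessianAt
  rw [← key, extChartAt_bodyModel_apply]
  change fderiv ℝ (fderiv ℝ ((h ∘ bodyAction I g) ∘
    (extChartAt (bodyModel I G) ((1 : G), μ)).symm)) y v w = _
  rw [heq.fderiv.fderiv_eq]

/-- The symplectic form on `T_{(e, μ)} (G × 𝔤*)`. -/
theorem bodyChartForm_one_apply [FiniteDimensional ℝ E] (μ : LieAlgebraDual I G)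
    (v w : E × (E →L[ℝ] ℝ)) :
    bodyChartForm I ((1 : G), μ) ![v, w] = w.2 v.1 - v.2 w.1 + coadjoint I (G := G) v.1 μ w.1 := by
  have hz := mem_extChartAt_target (I := I) (1 : G)
  have h₁ := coframeTwoForm_apply (A := maurerCartanInChart I (1 : G))
    (y := (extChartAt I (1 : G) 1, μ))
    ((contDiffAt_maurerCartanInChart I hz).differentiableAt (by simp)) v w
  have h₂ : coadjoint I (G := G) v.1 μ w.1 = μ (modelBracket I G v.1 w.1) := rfl
  have h₃ : modelBracket I G v.1 w.1 =
      -(fderiv ℝ (maurerCartanInChart I (1 : G)) (extChartAt I (1 : G) 1) v.1 w.1 -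
      fderiv ℝ (maurerCartanInChart I (1 : G)) (extChartAt I (1 : G) 1) w.1 v.1) := by
    rw [fderiv_maurerCartanInChart_sub, neg_neg]
  rw [h₂, h₃, map_neg, map_sub]
  refine h₁.trans ?_
  simp only [maurerCartanInChart_one]
  simp only [ContinuousLinearMap.id_apply]
  ring

/-- Splitting `ω_B(X_Q(p), ·) = d²f(p, ·)` at `(e, μ)` into its `𝔤` and `𝔤*` components. The
`𝔤*` component of the Hessian lies in `𝔤** ≃ 𝔤` and is, as an element of `𝔤`, the first component
of `X_Q(p)`. -/
theorem exists_hessian_components [FiniteDimensional ℝ E] {f : G × LieAlgebraDual I G → ℝ}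
    (hf : ContMDiff (bodyModel I G) 𝓘(ℝ, ℝ) ∞ f) (μ : LieAlgebraDual I G) :
    ∃ Hess : E × (E →L[ℝ] ℝ) →ₗ[ℝ] (E →L[ℝ] ℝ) × E,
      (∀ (ξ η : E) (τ ρ : E →L[ℝ] ℝ), (Hess (ξ, τ)).1 η + ρ (Hess (ξ, τ)).2 =
          hessianAt (bodyModel I G) f ((1 : G), μ) (ξ, τ) (η, ρ)) ∧
      ∀ (ξ : E) (τ : E →L[ℝ] ℝ),
        bodyLinearHamiltonianVectorField I f ((1 : G), μ) (ξ, τ) =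
          ((Hess (ξ, τ)).2, -(Hess (ξ, τ)).1 + coadjoint I (G := G) (Hess (ξ, τ)).2 μ) := by
  have hlin := isLinearMap_bodyLinearHamiltonianVectorField I hf ((1 : G), μ)
  have hspec : ∀ p w : E × (E →L[ℝ] ℝ), _ := fun p w =>
    (bodyChartForm_one_apply I μ (bodyLinearHamiltonianVectorField I f ((1 : G), μ) p) w).symm.trans
      (bodyLinearHamiltonianVectorField_spec I hf ((1 : G), μ) p w)
  let B : E × (E →L[ℝ] ℝ) →L[ℝ] E × (E →L[ℝ] ℝ) →L[ℝ] ℝ :=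
    fderiv ℝ (fderiv ℝ (f ∘ (extChartAt (bodyModel I G) ((1 : G), μ)).symm))
      (extChartAt (bodyModel I G) ((1 : G), μ) ((1 : G), μ))
  have hB : ∀ p w, hessianAt (bodyModel I G) f ((1 : G), μ) p w = B p w := fun _ _ => rfl
  let X : E × (E →L[ℝ] ℝ) →ₗ[ℝ] E × (E →L[ℝ] ℝ) := hlin.mk' _
  have hX : ∀ p, bodyLinearHamiltonianVectorField I f ((1 : G), μ) p = X p := fun _ => rfl
  simp only [hB, hX] at hspec ⊢
  -- restriction of a covector on `𝔤 × 𝔤*` to `𝔤`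
  let P : (E × (E →L[ℝ] ℝ) →L[ℝ] ℝ) →ₗ[ℝ] (E →L[ℝ] ℝ) :=
    { toFun := fun b => b ∘L ContinuousLinearMap.inl ℝ E (E →L[ℝ] ℝ)
      map_add' := fun _ _ => rfl
      map_smul' := fun _ _ => rfl }
  refine ⟨(P ∘ₗ (B : _ →ₗ[ℝ] _)).prod (LinearMap.fst ℝ E (E →L[ℝ] ℝ) ∘ₗ X), ?_, ?_⟩
  · intro ξ η τ ρ
    have h₁ : ρ (X (ξ, τ)).1 = B (ξ, τ) (0, ρ) := by
      rw [← hspec]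
      simp
    change B (ξ, τ) (η, 0) + ρ (X (ξ, τ)).1 = _
    rw [h₁, ← map_add]
    simp
  · intro ξ τ
    refine Prod.ext rfl (ContinuousLinearMap.ext fun η => ?_)
    have h₁ := hspec (ξ, τ) (η, 0)
    change (X (ξ, τ)).2 η = -B (ξ, τ) (η, 0) + coadjoint I (G := G) (X (ξ, τ)).1 μ η
    rw [← h₁]
    simp

end Translation
end

theorem mainTheorem5
    {E : Type*} [NormedAddCommGroup E] [NormedSpace ℝ E] [FiniteDimensional ℝ E]
    {H : Type*} [TopologicalSpace H] (I : ModelWithCorners ℝ E H) [I.Boundaryless]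
    {G : Type*} [TopologicalSpace G] [ChartedSpace H G] [Group G] [LieGroup I ∞ G]
    (h : G × LieAlgebraDual I G → ℝ)
    (hh : ContMDiff (bodyModel I G) 𝓘(ℝ, ℝ) ∞ h)
    (g : G) (μ : LieAlgebraDual I G)
    (heq : bodyHamiltonianVectorField I h (g, μ) = 0) :
    -- the two-form is nondegenerate, so that the Hamiltonian vector fields are well defined
    (∀ (z : G × LieAlgebraDual I G) (α : TangentSpace (bodyModel I G) z →L[ℝ] ℝ),
      ∃! v : TangentSpace (bodyModel I G) z, ∀ w : TangentSpace (bodyModel I G) z,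
        bodySymplecticForm I z ![v, w] = α w) ∧
    -- the equilibrium is moved to the identity fibre
    bodyAction I g ((1 : G), μ) = (g, μ) ∧
    bodyHamiltonianVectorField I (h ∘ bodyAction I g) ((1 : G), μ) = 0 ∧
    -- the tangent map conjugates the quadratic forms and the linear Hamiltonian vector fields
    bodyQuadraticForm I (h ∘ bodyAction I g) ((1 : G), μ) =
      bodyQuadraticForm I h (g, μ) ∘ bodyActionTangent I g μ ∧
    IsLinearMap ℝ (bodyLinearHamiltonianVectorField I h (g, μ)) ∧
    IsLinearMap ℝ (bodyLinearHamiltonianVectorField I (h ∘ bodyAction I g) ((1 : G), μ)) ∧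
    bodyActionTangent I g μ ∘
        bodyLinearHamiltonianVectorField I (h ∘ bodyAction I g) ((1 : G), μ) =
      bodyLinearHamiltonianVectorField I h (g, μ) ∘ bodyActionTangent I g μ ∧
    -- the linear Hamiltonian vector fields are the linearizations at the equilibria
    IsLinearizationAt (bodyModel I G) (bodyHamiltonianVectorField I h) (g, μ)
      (bodyLinearHamiltonianVectorField I h (g, μ)) ∧
    IsLinearizationAt (bodyModel I G) (bodyHamiltonianVectorField I (h ∘ bodyAction I g))
      ((1 : G), μ) (bodyLinearHamiltonianVectorField I (h ∘ bodyAction I g) ((1 : G), μ)) ∧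
    -- the explicit linearization at the identity
    ∃ Hess : GroupLieAlgebra I G × LieAlgebraDual I G →ₗ[ℝ]
        LieAlgebraDual I G × GroupLieAlgebra I G,
      (∀ (ξ η : GroupLieAlgebra I G) (τ ρ : LieAlgebraDual I G),
        (Hess (ξ, τ)).1 η + ρ (Hess (ξ, τ)).2 =
          hessianAt (bodyModel I G) (h ∘ bodyAction I g) ((1 : G), μ) (ξ, τ) (η, ρ)) ∧
      ∀ (ξ : GroupLieAlgebra I G) (τ : LieAlgebraDual I G),
        bodyLinearHamiltonianVectorField I (h ∘ bodyAction I g) ((1 : G), μ) (ξ, τ) =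
          ((Hess (ξ, τ)).2, -(Hess (ξ, τ)).1 + coadjoint I (Hess (ξ, τ)).2 μ) := by
  have hφ : bodyAction I g ((1 : G), μ) = (g, μ) := by rw [bodyAction_apply, mul_one]
  have hg : ContMDiff (bodyModel I G) 𝓘(ℝ, ℝ) ∞ (h ∘ bodyAction I g) :=
    hh.comp (contMDiff_bodyAction I g)
  have hcrit := (bodyHamiltonianVectorField_eq_zero_iff I h (g, μ)).1 heq
  have heq' : bodyHamiltonianVectorField I (h ∘ bodyAction I g) ((1 : G), μ) = 0 := by
    rw [bodyHamiltonianVectorField_eq_zero_iff, mfderiv_comp ((1 : G), μ)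
      (hh.contMDiffAt.mdifferentiableAt (by simp))
      ((contMDiff_bodyAction I g).contMDiffAt.mdifferentiableAt (by simp)), hφ]
    exact (congrArg (fun A : E × (E →L[ℝ] ℝ) →L[ℝ] ℝ => A ∘L bodyActionTangent I g μ) hcrit).trans
      (ContinuousLinearMap.zero_comp _)
  have hess := hessianAt_comp_bodyAction I hh g μ hcrit
  have hspec := bodyLinearHamiltonianVectorField_spec I hg ((1 : G), μ)
  have hlin := isLinearMap_bodyLinearHamiltonianVectorField I hg ((1 : G), μ)
  refine ⟨fun z α => ?_, hφ, heq', ?_, isLinearMap_bodyLinearHamiltonianVectorField I hh _, hlin,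
    ?_, isLinearizationAt_bodyHamiltonianVectorField I hh heq,
    isLinearizationAt_bodyHamiltonianVectorField I hg heq', ?_⟩
  · rw [bodySymplecticForm_eq]
    exact existsUnique_bodyChartForm I z α
  · ext1 v
    exact congrArg (fun r => (1 / 2 : ℝ) * r) (hess v v)
  · ext1 v
    refine eq_of_bodyChartForm_eq I (z := (g, μ)) fun u => ?_
    -- a symplectic map carrying one quadratic form to the other conjugates their vector fields
    obtain ⟨w, rfl⟩ := bodyActionTangent_surjective I g μ u
    simp only [Function.comp_apply]
    rw [bodyChartForm_bodyActionTangent, hspec, hess,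
      bodyLinearHamiltonianVectorField_spec I hh]
  · exact exists_hessian_components I hg μ
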